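/- **Setting.** Let $G$ be a compact topological group, with a $\sigma$-algebra for which the group operations (jointly in the two variables) and all continuous real functions are measurable (the Borel $\sigma$-algebra if $G$ is second countable, the Baire $\sigma$-algebra in general), and let $\mathrm dg$ be the normalized Haar measure, i.e. an invariant probability measure. Let $U$ be a projective unitary representation of $G$ on a finite-dimensional Hilbert space $H$: unitaries $U_g$ with $U_e=I$ and $U_gU_h=\omega(g,h)U_{gh}$ for a multiplier $\omega$ (that is, $|\omega(g,h)|=1$, $\omega(g,h)\,\omega(gh,k)=\omega(g,hk)\,\omega(h,k)$, $\omega(g,e)=\omega(e,g)=1$), such that $g\mapsto U_gAU_g^\dagger$ is continuous for every operator $A$ on $H$. Let $c:G\times G\to\mathbb R$ be a jointly measurable cost function with $c(g,g)\le c(\hat g,g)$ for all $\hat g,g$, and right-invariant: $c(\hat gh,gh)=c(\hat g,g)$ for all $\hat g,g,h$. A strategy with ancilla $\mathbb C^k$ is a density matrix $\sigma$ on $H\otimes\mathbb C^k$ together with a POVM $Q$ on $H\otimes\mathbb C^k$ with outcomes in $G$ (a countably additive map from the measurable sets to non-negative operators with $Q_G=I$). Its expected cost at $g$ is $c(\sigma,Q|g)=\int_G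 c(\hat g,g)\,\mathrm{Tr}[Q(\mathrm d\hat g)(U_g\otimes I)\sigma(U_g\otimes I)^\dagger]\in(-\infty,+\infty]$; its average cost is $c_{ave}(\sigma,Q)=\int_G c(\sigma,Q|g)\,\mathrm dg$ and its worst-case cost is $c_{wc}(\sigma,Q)=\sup_g c(\sigma,Q|g)$. The same definitions apply to strategies $(\rho,P)$ on $H$ alone, without ancilla. For each of the two costs, an input state is called optimal if the infimum of the cost over all POVMs for that state equals the infimum of the cost over all $k$, all input states on $H\otimes\mathbb C^k$ and all POVMs. **Theorem (Optimality of the class states).** There is a decomposition $H=\bigoplus_{\mu\in\mathsf{Irr}(U)}H_\mu\otimes\mathbb C^{m_\mu}$ in an orthonormal basis of $H$, with $U_g=\bigoplus_\mu U^\mu_g\otimes I_{m_\mu}$, $m_\mu\ge1$, where the $U^\mu$ are pairwise inequivalent irreducible projective unitary representations, with the multiplier $\omega$, on spaces $H_\mu$ of dimension $d_\mu$. Suppose that, for any such decomposition, $d_\mu\le m_\mu$ for every $\mu$, and regard $\widetilde H=\bigoplus_\mu H_\mu\otimes H_\mu$ as a subspace of $H$, the second factor $H_\mu$ being identified with the span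 of the first $d_\mu$ basis vectors of $\mathbb C^{m_\mu}$. For a probability vector $p=(p_\mu)$ let $\Phi_p$ be the class state $$|\Phi_p\rangle=\bigoplus_{\mu\in\mathsf{Irr}(U)}\sqrt{\frac{p_\mu}{d_\mu}}\;|I_\mu\rangle\!\rangle\in\widetilde H\subseteq H,\qquad |I_\mu\rangle\!\rangle=\sum_{i=1}^{d_\mu}|i\rangle|i\rangle .$$ Then for every $k$ and every input state $\sigma$ on $H\otimes\mathbb C^k$ there is a probability vector $p$ such that, for every POVM $Q$ on $H\otimes\mathbb C^k$, there is a POVM $P$ on $H$ with both $$c_{ave}(\Phi_p,P)\le c_{ave}(\sigma,Q)\qquad\text{and}\qquad c_{wc}(\Phi_p,P)\le c_{wc}(\sigma,Q).$$ In particular, if $\sigma$ is an optimal input state for the average approach, then so is $\Phi_p$; and if $\sigma$ is an optimal input state for the worst-case approach, then so is $\Phi_p$. -/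

import Mathlib

open MeasureTheory
open scoped ENNReal Matrix Kronecker ComplexOrder MatrixOrder

noncomputable section

namespace GroupEstimation

/-- A projective unitary representation of the group `G` on the Hilbert space with orthonormal
basis indexed by `n`, with multiplier `mult`. -/
structure ProjUnitaryRep (G : Type*) [Group G] (n : Type*) [Fintype n] [DecidableEq n] where
  /-- The unitary matrix `U_g`. -/
  mat : G → Matrix n n ℂ
  /-- The multiplier `ω (g, h)`. -/
  mult : G → G → ℂ
  mat_unitary : ∀ g, mat g ∈ Matrix.unitaryGroup n ℂ
  mat_one : mat 1 = 1
  mat_mul : ∀ g h, mat g * mat h = mult g h • mat (g * h)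
  norm_mult : ∀ g h, ‖mult g h‖ = 1
  mult_cocycle : ∀ g h k, mult g h * mult (g * h) k = mult g (h * k) * mult h k
  mult_one_right : ∀ g, mult g 1 = 1
  mult_one_left : ∀ g, mult 1 g = 1

namespace ProjUnitaryRep

variable {G : Type*} [Group G] {n : Type*} [Fintype n] [DecidableEq n]

/-- Continuity of a projective representation: the channels `A ↦ U_g A U_gᴴ` depend continuously
on `g`. The phases of the `U_g`, hence also the multiplier, need not be continuous. -/
def IsContinuous [TopologicalSpace G] (U : ProjUnitaryRep G n) : Prop :=
  ∀ A : Matrix n n ℂ, Continuous fun g => U.mat g * A * (U.mat g)ᴴ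

/-- The representation `g ↦ U_g ⊗ I` on the original system together with an ancilla. -/
def withAncilla (U : ProjUnitaryRep G n) (κ : Type*) [Fintype κ] [DecidableEq κ] :
    ProjUnitaryRep G (n × κ) where
  mat g := U.mat g ⊗ₖ (1 : Matrix κ κ ℂ)
  mult := U.mult
  mat_unitary g := Matrix.kronecker_mem_unitary (U.mat_unitary g) (one_mem _)
  mat_one := by rw [U.mat_one, Matrix.one_kronecker_one]
  mat_mul g h := by
    rw [← Matrix.mul_kronecker_mul, U.mat_mul, one_mul, Matrix.smul_kronecker]
  norm_mult := U.norm_mult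
  mult_cocycle := U.mult_cocycle
  mult_one_right := U.mult_one_right
  mult_one_left := U.mult_one_left

/-- Irreducibility: the space is nonzero, and the only invariant subspaces are the trivial ones. -/
def IsIrreducible (U : ProjUnitaryRep G n) : Prop :=
  Nonempty n ∧ ∀ S : Submodule ℂ (n → ℂ),
    (∀ g, ∀ v ∈ S, U.mat g *ᵥ v ∈ S) → S = ⊥ ∨ S = ⊤

/-- Two representations are equivalent if they are related by an invertible intertwiner. -/
def IsEquivalent {m : Type*} [Fintype m] [DecidableEq m]
    (U : ProjUnitaryRep G n) (W : ProjUnitaryRep G m) : Prop :=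
  ∃ (T : Matrix n m ℂ) (T' : Matrix m n ℂ),
    T * T' = 1 ∧ T' * T = 1 ∧ ∀ g, U.mat g * T = T * W.mat g

end ProjUnitaryRep

/-- An isotypic decomposition `H = ⨁_μ H_μ ⊗ ℂ^{m_μ}`, `U = ⨁_μ U^μ ⊗ I_{m_μ}`, where the `U^μ`
are pairwise inequivalent irreducible representations with the same multiplier as `U`, each of
which occurs (`0 < m_μ`). The unitary matrix `basis` is the change of orthonormal basis. -/
structure IsotypicDecomposition {G : Type*} [Group G] {n : Type*} [Fintype n] [DecidableEq n]
    (U : ProjUnitaryRep G n) where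
  /-- The index set `Irr(U)`. -/
  Irr : Type
  [fintypeIrr : Fintype Irr]
  [decidableEqIrr : DecidableEq Irr]
  /-- The dimension `d_μ`. -/
  d : Irr → ℕ
  /-- The multiplicity `m_μ`. -/
  m : Irr → ℕ
  /-- The irreducible representation `U^μ`. -/
  irrep : ∀ μ, ProjUnitaryRep G (Fin (d μ))
  mult_irrep : ∀ μ, (irrep μ).mult = U.mult
  irreducible : ∀ μ, (irrep μ).IsIrreducible
  inequivalent : ∀ μ ν, μ ≠ ν → ¬ (irrep μ).IsEquivalent (irrep ν)
  m_pos : ∀ μ, 0 < m μ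
  /-- The columns are an orthonormal basis of `H` adapted to the decomposition. -/
  basis : Matrix n (Σ μ, Fin (d μ) × Fin (m μ)) ℂ
  basis_mul_conjTranspose : basis * basisᴴ = 1
  conjTranspose_mul_basis : basisᴴ * basis = 1
  mat_eq : ∀ g, U.mat g = basis *
    Matrix.blockDiagonal' (fun μ => (irrep μ).mat g ⊗ₖ (1 : Matrix (Fin (m μ)) (Fin (m μ)) ℂ)) *
      basisᴴ

attribute [instance] IsotypicDecomposition.fintypeIrr IsotypicDecomposition.decidableEqIrr

/-- A quantum state (density matrix). -/
structure State (n : Type*) [Fintype n] where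
  /-- The density matrix. -/
  mat : Matrix n n ℂ
  posSemidef : mat.PosSemidef
  trace_eq_one : mat.trace = 1

namespace State

variable {n : Type*} [Fintype n]

/-- The pure state `|ψ⟩⟨ψ|` of a unit vector `ψ`. -/
def ofVec (ψ : n → ℂ) (hψ : star ψ ⬝ᵥ ψ = 1) : State n where
  mat := Matrix.vecMulVec ψ (star ψ)
  posSemidef := Matrix.posSemidef_vecMulVec_self_star ψ
  trace_eq_one := by rw [Matrix.trace_vecMulVec, dotProduct_comm, hψ]

/-- The output state `ρ_g = U_g ρ U_gᴴ`. -/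
def evolve {G : Type*} [Group G] [DecidableEq n] (ρ : State n) (U : ProjUnitaryRep G n) (g : G) :
    State n where
  mat := U.mat g * ρ.mat * (U.mat g)ᴴ
  posSemidef := ρ.posSemidef.mul_mul_conjTranspose_same _
  trace_eq_one := by
    have h : (U.mat g)ᴴ * U.mat g = 1 := (Matrix.mem_unitaryGroup_iff').1 (U.mat_unitary g)
    rw [Matrix.trace_mul_comm, ← mul_assoc, h, one_mul, ρ.trace_eq_one]

end State

namespace IsotypicDecomposition

variable {G : Type*} [Group G] {n : Type*} [Fintype n] [DecidableEq n] {U : ProjUnitaryRep G n}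

/-- The coordinates of `⨁_μ √(p_μ / d_μ) |I_μ⟩⟩ ∈ ⨁_μ H_μ ⊗ H_μ` in `⨁_μ H_μ ⊗ ℂ^{m_μ}`, where
the second copy of `H_μ` is spanned by the first `d_μ` basis vectors of `ℂ^{m_μ}`. -/
def classCoord (D : IsotypicDecomposition U) (p : D.Irr → ℝ) :
    (Σ μ, Fin (D.d μ) × Fin (D.m μ)) → ℂ :=
  fun x => if (x.2.1 : ℕ) = (x.2.2 : ℕ) then ((√(p x.1 / D.d x.1) : ℝ) : ℂ) else 0

/-- The class vector `⨁_μ √(p_μ / d_μ) |I_μ⟩⟩` as an element of `H`. -/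
def classVec (D : IsotypicDecomposition U) (p : D.Irr → ℝ) : n → ℂ :=
  D.basis *ᵥ D.classCoord p

theorem star_classVec_dotProduct (D : IsotypicDecomposition U) (hdm : ∀ μ, D.d μ ≤ D.m μ)
    (p : stdSimplex ℝ D.Irr) : star (D.classVec p) ⬝ᵥ D.classVec p = 1 := by
  have h1 : star (D.classVec p) ⬝ᵥ D.classVec p = star (D.classCoord p) ⬝ᵥ D.classCoord p := by
    rw [classVec, Matrix.star_mulVec, ← Matrix.dotProduct_mulVec, Matrix.mulVec_mulVec,
      D.conjTranspose_mul_basis, Matrix.one_mulVec]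
  have h2 : ∀ μ, ∑ y : Fin (D.d μ) × Fin (D.m μ),
      star (D.classCoord p ⟨μ, y⟩) * D.classCoord p ⟨μ, y⟩ = ((p μ : ℝ) : ℂ) := by
    intro μ
    have hd : 0 < D.d μ := Fin.pos_iff_nonempty.2 (D.irreducible μ).1
    have hp : 0 ≤ p μ := p.2.1 μ
    have hsq : ((√(p μ / D.d μ) : ℝ) : ℂ) * ((√(p μ / D.d μ) : ℝ) : ℂ)
        = ((p μ / D.d μ : ℝ) : ℂ) := by
      rw [← Complex.ofReal_mul, Real.mul_self_sqrt (by positivity)]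
    rw [Fintype.sum_prod_type]
    have hi : ∀ i : Fin (D.d μ), ∑ j : Fin (D.m μ),
        star (D.classCoord p ⟨μ, (i, j)⟩) * D.classCoord p ⟨μ, (i, j)⟩
          = ((p μ / D.d μ : ℝ) : ℂ) := by
      intro i
      rw [Finset.sum_eq_single (Fin.castLE (hdm μ) i)]
      · simp only [classCoord, Fin.val_castLE, if_true]
        rw [← hsq]
        simp
      · intro j _ hj
        have : (i : ℕ) ≠ (j : ℕ) := fun h => hj (Fin.ext (by simpa using h.symm))
        simp [classCoord, this]
      · simp
    rw [Finset.sum_congr rfl fun i _ => hi i, Finset.sum_const, Finset.card_univ,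
      Fintype.card_fin, nsmul_eq_mul]
    have hd' : (D.d μ : ℂ) ≠ 0 := by exact_mod_cast hd.ne'
    push_cast
    field_simp
  rw [h1, dotProduct, Fintype.sum_sigma]
  simp only [Pi.star_apply]
  rw [Finset.sum_congr rfl fun μ _ => h2 μ, ← Complex.ofReal_sum]
  exact_mod_cast p.2.2

/-- The class state `|Φ⟩⟨Φ|`, `|Φ⟩ = ⨁_μ √(p_μ / d_μ) |I_μ⟩⟩`, of a probability vector `p`. -/
def classState (D : IsotypicDecomposition U) (hdm : ∀ μ, D.d μ ≤ D.m μ)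
    (p : stdSimplex ℝ D.Irr) : State n :=
  State.ofVec (D.classVec p) (D.star_classVec_dotProduct hdm p)

end IsotypicDecomposition

/-- A positive operator-valued measure with outcomes in `G`. -/
structure POVM (G : Type*) [MeasurableSpace G] (n : Type*) [Fintype n] [DecidableEq n] where
  /-- The countably additive operator-valued set function `B ↦ P_B`. -/
  toVectorMeasure : VectorMeasure G (Matrix n n ℂ)
  posSemidef : ∀ B, (toVectorMeasure B).PosSemidef
  univ_eq_one : toVectorMeasure Set.univ = 1

theorem trace_mul_re_nonneg {n : Type*} [Fintype n] {A B : Matrix n n ℂ}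
    (hA : A.PosSemidef) (hB : B.PosSemidef) : 0 ≤ (A * B).trace.re := by
  classical
  obtain ⟨C, rfl⟩ := CStarAlgebra.nonneg_iff_eq_star_mul_self.1 hA.nonneg
  rw [Matrix.star_eq_conjTranspose]
  have h := (hB.mul_mul_conjTranspose_same C).trace_nonneg
  rw [Matrix.trace_mul_comm, ← mul_assoc] at h
  exact (Complex.le_def.1 h).1

section Cost

variable {G : Type*} [MeasurableSpace G] {n : Type*} [Fintype n] [DecidableEq n]

/-- The Born rule: the outcome distribution `B ↦ Tr[P_B ρ]`. -/
def bornMeasure (P : POVM G n) (ρ : State n) : Measure G :=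
  Measure.ofMeasurable (fun B _ => ENNReal.ofReal (P.toVectorMeasure B * ρ.mat).trace.re)
    (by simp)
    (by
      intro f hf hd
      have hc : Continuous fun A : Matrix n n ℂ => (A * ρ.mat).trace.re :=
        Complex.continuous_re.comp (Continuous.matrix_trace (continuous_id.matrix_mul
          continuous_const))
      let φ : Matrix n n ℂ →+ ℝ :=
        { toFun := fun A => (A * ρ.mat).trace.re
          map_zero' := by simp
          map_add' := fun A B => by simp [add_mul] }
      have hs : HasSum (fun i => (P.toVectorMeasure (f i) * ρ.mat).trace.re)
          (P.toVectorMeasure (⋃ i, f i) * ρ.mat).trace.re :=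
        (P.toVectorMeasure.m_iUnion hf hd).map φ hc
      rw [← hs.tsum_eq]
      exact ENNReal.ofReal_tsum_of_nonneg
        (fun i => trace_mul_re_nonneg (P.posSemidef _) ρ.posSemidef) hs.summable)

/-- The integral `∫ f⁺ - ∫ f⁻` of an extended-real function. It is used only for functions that
are bounded below, on probability spaces. -/
def extIntegral {X : Type*} [MeasurableSpace X] (ν : Measure X) (f : X → EReal) : EReal :=
  ((∫⁻ x, (f x).toENNReal ∂ν : ℝ≥0∞) : EReal) - ((∫⁻ x, (-f x).toENNReal ∂ν : ℝ≥0∞) : EReal)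

variable [Group G]

/-- The expected cost `c(ρ, P | g) = ∫ c(ĝ, g) Tr[P(dĝ) ρ_g]` when the true value is `g`. -/
def condCost (c : G → G → ℝ) (U : ProjUnitaryRep G n) (ρ : State n) (P : POVM G n) (g : G) :
    EReal :=
  extIntegral (bornMeasure P (ρ.evolve U g)) fun x => (c x g : EReal)

/-- The average cost `∫ c(ρ, P | g) dg`. -/
def averageCost (haar : Measure G) (c : G → G → ℝ) (U : ProjUnitaryRep G n) (ρ : State n)
    (P : POVM G n) : EReal :=
  extIntegral haar fun g => condCost c U ρ P g

/-- The worst-case cost, the supremum of `c(ρ, P | g)` over `g`. -/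
def worstCaseCost (c : G → G → ℝ) (U : ProjUnitaryRep G n) (ρ : State n) (P : POVM G n) : EReal :=
  ⨆ g, condCost c U ρ P g

/-- The least average cost (as an infimum) attainable with the input state `ρ`. -/
def bestAverageCost (haar : Measure G) (c : G → G → ℝ) (U : ProjUnitaryRep G n) (ρ : State n) :
    EReal :=
  ⨅ P : POVM G n, averageCost haar c U ρ P

/-- The least worst-case cost (as an infimum) attainable with the input state `ρ`. -/
def bestWorstCaseCost (c : G → G → ℝ) (U : ProjUnitaryRep G n) (ρ : State n) : EReal :=
  ⨅ P : POVM G n, worstCaseCost c U ρ P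

/-- The infimum of the average cost over all input states of `H ⊗ ℂ^k`, with an ancilla of
arbitrary dimension `k`, and all POVMs. -/
def optimalAverageCost (haar : Measure G) (c : G → G → ℝ) (U : ProjUnitaryRep G n) : EReal :=
  ⨅ (k : ℕ) (ρ : State (n × Fin k)), bestAverageCost haar c (U.withAncilla (Fin k)) ρ

/-- The infimum of the worst-case cost over all input states of `H ⊗ ℂ^k`, with an ancilla of
arbitrary dimension `k`, and all POVMs. -/
def optimalWorstCaseCost (c : G → G → ℝ) (U : ProjUnitaryRep G n) : EReal :=
  ⨅ (k : ℕ) (ρ : State (n × Fin k)), bestWorstCaseCost c (U.withAncilla (Fin k)) ρ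

end Cost

end GroupEstimation

end

open GroupEstimation

/-! Write `σ = C Cᴴ`, let `Ψ_μ` be the part of `C` in block `μ`, read as a matrix with `d_μ` rows
whose columns carry all other indices (multiplicity, ancilla, column of `C`), and put `p_μ = Tr Ψ_μ
Ψ_μᴴ`. Because `(I ⊗ Xᵀ)|I⟩⟩ = |X⟩⟩`, the operators `⨁_μ √(d_μ / p_μ) I ⊗ (U^μ_h Ψ_μ)ᵀ` send `U_g
Φ_p` to `U_g U_h C`, which is `U_{gh} C` up to a phase. Thus the class state at the unknown `g` can
simulate `σ` at `gh`.

For fixed `h` these operators need not preserve the trace, but their Haar mean is under control: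
Schur's lemma gives `∫ U^μ_h Ψ_μ Ψ_μᴴ (U^μ_h)ᴴ dh = (p_μ / d_μ) I`. With `h` kept as a random
outcome they resolve the identity, up to a projection that annihilates every `U_g Φ_p`
(`entryIntegral_sum_kraus`, `exists_isRightTransfer`).

Now measure `Q` on the simulated state and report `x h⁻¹`. Since `c(x h⁻¹, g) = c(x, gh)` and Haar
measure is left-invariant, the resulting `P` has conditional cost `c_ave(σ, Q)` at every `g`
(`IsRightTransfer.exists_condCost_eq`). Its average and its supremum are then at most `c_ave(σ, Q) ≤
c_wc(σ, Q)`, so the same `p` and `P` serve both criteria.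

Two analytic points need care. The phases of `U_g` are arbitrary, so only products of an entry with
a conjugate entry are known to be continuous (`continuous_mul_star`). And `Q` is an abstract
operator measure, so it is given a matrix density before it is combined with Haar measure
(`POVM.exists_eq_ofDensity`). The isotypic decomposition comes from a maximal orthogonal family of
irreducible subrepresentations, grouped by equivalence. -/

noncomputable section

namespace GroupEstimation

/-! ### Extended integrals of functions bounded below -/

section ExtIntegral

variable {X : Type*} [MeasurableSpace X] {ν : Measure X} [IsProbabilityMeasure ν] {F : X → EReal}

theorem coe_toENNReal_sub_coe_toENNReal_neg (s : EReal) :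
    ((s.toENNReal : ℝ≥0∞) : EReal) - (((-s).toENNReal : ℝ≥0∞) : EReal) = s := by
  rcases le_total 0 s with h | h
  · rw [EReal.coe_toENNReal h, EReal.toENNReal_of_nonpos (by simpa using EReal.neg_le_neg_iff.2 h)]
    simp
  · rw [EReal.toENNReal_of_nonpos h, EReal.coe_toENNReal (by simpa using EReal.neg_le_neg_iff.2 h)]
    simp

/-- Monotonicity of `∫⁻` and total mass one suffice, so `F` need not be measurable. -/
theorem extIntegral_le_of_le {s : EReal} (h : ∀ x, F x ≤ s) : extIntegral ν F ≤ s := by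
  have h1 : ∫⁻ x, (F x).toENNReal ∂ν ≤ s.toENNReal := by
    calc ∫⁻ x, (F x).toENNReal ∂ν ≤ ∫⁻ _, s.toENNReal ∂ν :=
          lintegral_mono fun x => EReal.toENNReal_le_toENNReal (h x)
      _ = s.toENNReal := by simp
  have h2 : (-s).toENNReal ≤ ∫⁻ x, (-F x).toENNReal ∂ν := by
    calc (-s).toENNReal = ∫⁻ _, (-s).toENNReal ∂ν := by simp
      _ ≤ _ := lintegral_mono fun x => EReal.toENNReal_le_toENNReal (EReal.neg_le_neg_iff.2 (h x))
  calc extIntegral ν F ≤ ((s.toENNReal : ℝ≥0∞) : EReal) - (((-s).toENNReal : ℝ≥0∞) : EReal) :=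
        EReal.sub_le_sub (EReal.coe_ennreal_le_coe_ennreal_iff.2 h1)
          (EReal.coe_ennreal_le_coe_ennreal_iff.2 h2)
    _ = s := coe_toENNReal_sub_coe_toENNReal_neg s

/-- This is `s = s⁺ - s⁻` for `s = a + y`, arranged without subtraction so that it survives `y = ∞`
and can be integrated term by term. -/
theorem toENNReal_coe_add (a : ℝ) (y : ℝ≥0∞) :
    ((a : EReal) + (y : EReal)).toENNReal + ENNReal.ofReal (-a)
      = y + (-((a : EReal) + (y : EReal))).toENNReal + ENNReal.ofReal a := by
  induction y using ENNReal.recTopCoe with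
  | top => simp
  | coe r =>
    have e : ((r : ℝ≥0∞) : EReal) = ((r : ℝ) : EReal) := rfl
    have e2 : (r : ℝ≥0∞) = ENNReal.ofReal r := by simp
    rw [e, ← EReal.coe_add, ← EReal.coe_neg, EReal.toENNReal_of_ne_top (EReal.coe_ne_top _),
      EReal.toENNReal_of_ne_top (EReal.coe_ne_top _), EReal.toReal_coe, EReal.toReal_coe, e2]
    have hr : 0 ≤ (r : ℝ) := r.2
    rw [← ENNReal.toReal_eq_toReal_iff' (by finiteness) (by finiteness),
      ENNReal.toReal_add (by finiteness) (by finiteness),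
      ENNReal.toReal_add (by finiteness) (by finiteness),
      ENNReal.toReal_add (by finiteness) (by finiteness)]
    simp only [ENNReal.toReal_ofReal', max_def]
    split_ifs <;> linarith

/-- The extended integral of a function bounded below, with the lower bound split off. -/
theorem extIntegral_coe_add (a : ℝ) {f : X → ℝ≥0∞} (hf : Measurable f) :
    extIntegral ν (fun x => (a : EReal) + (f x : EReal))
      = (a : EReal) + ((∫⁻ x, f x ∂ν : ℝ≥0∞) : EReal) := by
  have h := lintegral_congr (μ := ν) fun x => toENNReal_coe_add a (f x)
  rw [lintegral_add_right _ measurable_const, lintegral_add_right _ measurable_const,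
    lintegral_add_left hf] at h
  simp only [lintegral_const, measure_univ, mul_one] at h
  -- The negative part is dominated by that of `a`, so its integral is finite and `∞ - ∞` cannot
  -- occur.
  have hfin : ∫⁻ x, (-((a : EReal) + (f x : EReal))).toENNReal ∂ν ≤ ENNReal.ofReal (-a) := by
    calc _ ≤ ∫⁻ _, ENNReal.ofReal (-a) ∂ν := by
          refine lintegral_mono fun x => ?_
          have h1 : -((a : EReal) + (f x : EReal)) ≤ ((-a : ℝ) : EReal) := by
            rw [EReal.coe_neg, EReal.neg_le_neg_iff]
            exact le_add_of_nonneg_right (EReal.coe_ennreal_nonneg _)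
          have h2 := EReal.toENNReal_le_toENNReal h1
          rwa [EReal.toENNReal_of_ne_top (EReal.coe_ne_top (-a)), EReal.toReal_coe] at h2
      _ = _ := by simp
  unfold extIntegral
  generalize ∫⁻ x, (-((a : EReal) + (f x : EReal))).toENNReal ∂ν = N at *
  generalize ∫⁻ x, ((a : EReal) + (f x : EReal)).toENNReal ∂ν = M at *
  generalize ∫⁻ x, f x ∂ν = I at *
  lift N to NNReal using ne_top_of_le_ne_top ENNReal.ofReal_ne_top hfin
  induction I using ENNReal.recTopCoe with
  | top =>
    simp only [top_add] at h
    have : M = ⊤ := by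
      by_contra hM
      exact ENNReal.add_ne_top.2 ⟨hM, ENNReal.ofReal_ne_top⟩ h
    subst this
    have e : ((N : ℝ≥0∞) : EReal) = ((N : ℝ) : EReal) := rfl
    rw [e]
    simp
  | coe I =>
    have hM : M ≠ ⊤ := by
      intro hM
      rw [hM, top_add] at h
      exact absurd h.symm (by finiteness)
    lift M to NNReal using hM
    have e : ∀ r : NNReal, ((r : ℝ≥0∞) : EReal) = ((r : ℝ) : EReal) := fun _ => rfl
    rw [e, e, e, ← EReal.coe_sub, ← EReal.coe_add, EReal.coe_eq_coe_iff]
    rw [← ENNReal.toReal_eq_toReal_iff' (by finiteness) (by finiteness),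
      ENNReal.toReal_add (by finiteness) (by finiteness),
      ENNReal.toReal_add (by finiteness) (by finiteness),
      ENNReal.toReal_add (by finiteness) (by finiteness)] at h
    simp only [ENNReal.toReal_ofReal', ENNReal.coe_toReal] at h
    rcases le_total 0 a with ha | ha
    · rw [max_eq_left ha, max_eq_right (by linarith)] at h; linarith
    · rw [max_eq_right ha, max_eq_left (by linarith)] at h; linarith

end ExtIntegral

/-! ### POVMs given by matrix densities -/

section Density

variable {Z : Type*} [MeasurableSpace Z] {n : Type*} [Fintype n]

/-- `q` is a matrix density, with respect to `τ`, of a positive operator-valued measure. -/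
structure IsPOVMDensity [DecidableEq n] (τ : Measure Z) (q : Z → Matrix n n ℂ) : Prop where
  measurable : ∀ a b, Measurable fun z => q z a b
  integrable : ∀ a b, Integrable (fun z => q z a b) τ
  posSemidef : ∀ᵐ z ∂τ, (q z).PosSemidef
  integral_eq : ∀ a b, ∫ z, q z a b ∂τ = (1 : Matrix n n ℂ) a b

theorem integrable_trace_mul {τ : Measure Z} {q : Z → Matrix n n ℂ}
    (hq : ∀ a b, Integrable (fun z => q z a b) τ) (C : Matrix n n ℂ) :
    Integrable (fun z => (q z * C).trace) τ := by
  simp only [Matrix.trace, Matrix.diag, Matrix.mul_apply]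
  exact integrable_finsetSum _ fun a _ => integrable_finsetSum _ fun b _ => (hq a b).mul_const _

theorem integral_trace_mul {τ : Measure Z} {q : Z → Matrix n n ℂ}
    (hq : ∀ a b, Integrable (fun z => q z a b) τ) (C : Matrix n n ℂ) :
    ∫ z, (q z * C).trace ∂τ = ((Matrix.of fun a b => ∫ z, q z a b ∂τ) * C).trace := by
  simp only [Matrix.trace, Matrix.diag, Matrix.mul_apply, Matrix.of_apply]
  rw [integral_finsetSum _ fun a _ => integrable_finsetSum _ fun b _ => (hq a b).mul_const _]
  refine Finset.sum_congr rfl fun a _ => ?_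
  rw [integral_finsetSum _ fun b _ => (hq a b).mul_const _]
  exact Finset.sum_congr rfl fun b _ => integral_mul_const _ _

theorem trace_mul_vecMulVec_star (M : Matrix n n ℂ) (v : n → ℂ) :
    (M * Matrix.vecMulVec v (star v)).trace = star v ⬝ᵥ M *ᵥ v := by
  rw [Matrix.mul_vecMulVec, Matrix.trace_vecMulVec, dotProduct_comm]

theorem posSemidef_integral {τ : Measure Z} {q : Z → Matrix n n ℂ}
    (hq : ∀ a b, Integrable (fun z => q z a b) τ) (hp : ∀ᵐ z ∂τ, (q z).PosSemidef) :
    (Matrix.of fun a b => ∫ z, q z a b ∂τ).PosSemidef := by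
  refine Matrix.PosSemidef.of_dotProduct_mulVec_nonneg ?_ fun v => ?_
  · ext a b
    simp only [Matrix.conjTranspose_apply, Matrix.of_apply]
    rw [Complex.star_def, ← integral_conj]
    refine integral_congr_ae ?_
    filter_upwards [hp] with z hz
    rw [← hz.1.apply b a]
    simp
  · rw [← trace_mul_vecMulVec_star, ← integral_trace_mul hq, Complex.le_def]
    have hn : ∀ᵐ z ∂τ, 0 ≤ (q z * Matrix.vecMulVec v (star v)).trace := by
      filter_upwards [hp] with z hz
      rw [trace_mul_vecMulVec_star]
      exact hz.dotProduct_mulVec_nonneg v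
    have hi := integrable_trace_mul hq (Matrix.vecMulVec v (star v))
    constructor
    · rw [← Complex.reCLM_apply (∫ z, _ ∂τ), ← ContinuousLinearMap.integral_comp_comm _ hi]
      refine integral_nonneg_of_ae ?_
      filter_upwards [hn] with z hz using (Complex.le_def.1 hz).1
    · rw [← Complex.imCLM_apply (∫ z, _ ∂τ), ← ContinuousLinearMap.integral_comp_comm _ hi]
      symm
      refine integral_eq_zero_of_ae ?_
      filter_upwards [hn] with z hz using (Complex.le_def.1 hz).2.symm

variable {G : Type*} [MeasurableSpace G] [DecidableEq n]

open Classical in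
/-- The image under `t` of the positive operator-valued measure with density `q`. -/
def POVM.ofDensity {τ : Measure Z} {q : Z → Matrix n n ℂ} (h : IsPOVMDensity τ q) (t : Z → G)
    (ht : Measurable t) : POVM G n where
  toVectorMeasure :=
    { measureOf' := fun B => if MeasurableSet B then
        Matrix.of fun a b => ∫ z in t ⁻¹' B, q z a b ∂τ else 0
      empty' := by ext; simp
      not_measurable' := fun B hB => if_neg hB
      m_iUnion' := by
        intro B hB hd
        simp only [hB, if_true, MeasurableSet.iUnion hB]
        refine Pi.hasSum.2 fun a => Pi.hasSum.2 fun b => ?_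
        simp only [Matrix.of_apply, Set.preimage_iUnion]
        exact hasSum_integral_iUnion (fun i => ht (hB i)) (fun i j hij => (hd hij).preimage _)
          (h.integrable a b).integrableOn }
  posSemidef B := by
    by_cases hB : MeasurableSet B
    · simp only [VectorMeasure.coe_mk, hB, if_true]
      exact posSemidef_integral (fun a b => (h.integrable a b).restrict)
        (ae_restrict_of_ae h.posSemidef)
    · simp only [VectorMeasure.coe_mk, hB, if_false]
      exact Matrix.PosSemidef.zero
  univ_eq_one := by
    ext a b
    simp [h.integral_eq a b]

theorem POVM.ofDensity_apply {τ : Measure Z} {q : Z → Matrix n n ℂ} (h : IsPOVMDensity τ q)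
    {t : Z → G} (ht : Measurable t) {B : Set G} (hB : MeasurableSet B) :
    (POVM.ofDensity h t ht).toVectorMeasure B
      = Matrix.of fun a b => ∫ z in t ⁻¹' B, q z a b ∂τ :=
  if_pos hB

theorem bornMeasure_apply (P : POVM G n) (ρ : State n) {B : Set G} (hB : MeasurableSet B) :
    bornMeasure P ρ B = ENNReal.ofReal (P.toVectorMeasure B * ρ.mat).trace.re :=
  Measure.ofMeasurable_apply B hB

instance (P : POVM G n) (ρ : State n) : IsProbabilityMeasure (bornMeasure P ρ) where
  measure_univ := by
    rw [bornMeasure_apply P ρ MeasurableSet.univ, P.univ_eq_one, one_mul, ρ.trace_eq_one]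
    simp

theorem bornMeasure_ofDensity {τ : Measure Z} {q : Z → Matrix n n ℂ} (h : IsPOVMDensity τ q)
    {t : Z → G} (ht : Measurable t) (ρ : State n) :
    bornMeasure (POVM.ofDensity h t ht) ρ
      = (τ.withDensity fun z => ENNReal.ofReal (q z * ρ.mat).trace.re).map t := by
  ext B hB
  have hi := (integrable_trace_mul h.integrable ρ.mat)
  rw [bornMeasure_apply _ _ hB, POVM.ofDensity_apply h ht hB, Measure.map_apply ht hB,
    withDensity_apply _ (ht hB),
    ← integral_trace_mul (τ := τ.restrict (t ⁻¹' B)) fun a b => (h.integrable a b).restrict,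
    ← Complex.reCLM_apply (∫ z in _, _ ∂τ),
    ← ContinuousLinearMap.integral_comp_comm _ hi.restrict,
    ofReal_integral_eq_lintegral_ofReal]
  · rfl
  · exact (Complex.reCLM.integrable_comp hi).restrict
  · refine ae_restrict_of_ae ?_
    filter_upwards [h.posSemidef] with z hz
    exact trace_mul_re_nonneg hz ρ.posSemidef

theorem IsPOVMDensity.measurable_trace_mul {τ : Measure Z} {q : Z → Matrix n n ℂ}
    (h : IsPOVMDensity τ q) (C : Matrix n n ℂ) : Measurable fun z => (q z * C).trace := by
  simp only [Matrix.trace, Matrix.diag, Matrix.mul_apply]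
  exact Finset.measurable_sum _ fun a _ => Finset.measurable_sum _ fun b _ =>
    (h.measurable a b).mul_const _

theorem lintegral_bornMeasure_ofDensity {τ : Measure Z} {q : Z → Matrix n n ℂ}
    (h : IsPOVMDensity τ q) {t : Z → G} (ht : Measurable t) (ρ : State n) {f : G → ℝ≥0∞}
    (hf : Measurable f) :
    ∫⁻ x, f x ∂bornMeasure (POVM.ofDensity h t ht) ρ
      = ∫⁻ z, f (t z) * ENNReal.ofReal (q z * ρ.mat).trace.re ∂τ := by
  have hm : Measurable fun z => ENNReal.ofReal (q z * ρ.mat).trace.re :=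
    (Complex.measurable_re.comp (h.measurable_trace_mul _)).ennreal_ofReal
  rw [bornMeasure_ofDensity, lintegral_map hf ht]
  refine (lintegral_withDensity_eq_lintegral_mul _ hm (hf.comp ht)).trans ?_
  exact lintegral_congr fun z => mul_comm _ _

end Density

/-! ### Every POVM has a matrix density -/

section RadonNikodym

/-- The maximally mixed state. -/
def State.maximallyMixed (n : Type*) [Fintype n] [DecidableEq n] [Nonempty n] : State n where
  mat := ((Fintype.card n : ℝ)⁻¹ : ℝ) • 1
  posSemidef := Matrix.PosSemidef.one.smul (by positivity)
  trace_eq_one := by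
    rw [Matrix.trace_smul, Matrix.trace_one]
    have : (Fintype.card n : ℂ) ≠ 0 := by simp
    simp [this]

variable {X : Type*} [MeasurableSpace X] {n : Type*} [Fintype n]

theorem exists_setIntegral_eq_signedMeasure (τ : Measure X) [SigmaFinite τ] (s : SignedMeasure X)
    (h : ∀ B, MeasurableSet B → τ B = 0 → s B = 0) :
    ∃ f : X → ℝ, Measurable f ∧ Integrable f τ ∧
      ∀ B, MeasurableSet B → s B = ∫ x in B, f x ∂τ := by
  refine ⟨s.rnDeriv τ, s.measurable_rnDeriv τ, s.integrable_rnDeriv τ, fun B hB => ?_⟩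
  have hac : s ≪ᵥ τ.toENNRealVectorMeasure := VectorMeasure.AbsolutelyContinuous.mk
    fun B hB h0 => h B hB (by rwa [Measure.toENNRealVectorMeasure_apply_measurable hB] at h0)
  have := SignedMeasure.absolutelyContinuous_iff_withDensityᵥ_rnDeriv_eq s τ |>.1 hac
  rw [← withDensityᵥ_apply (s.integrable_rnDeriv τ) hB, this]

/-- For one vector `v`, nonnegative set integrals of `v† q v` give nonnegativity almost everywhere.
Testing a countable dense set of vectors makes the null set independent of `v`, and continuity in
`v` does the rest. -/
theorem ae_posSemidef_of_setIntegral {τ : Measure X} [IsFiniteMeasure τ]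
    {q : X → Matrix n n ℂ} (hq : ∀ a b, Integrable (fun x => q x a b) τ)
    (h : ∀ B, MeasurableSet B → (Matrix.of fun a b => ∫ x in B, q x a b ∂τ).PosSemidef) :
    ∀ᵐ x ∂τ, (q x).PosSemidef := by
  have hherm : ∀ᵐ x ∂τ, ∀ a b, star (q x b a) = q x a b := by
    refine ae_all_iff.2 fun a => ae_all_iff.2 fun b => ?_
    refine Integrable.ae_eq_of_forall_setIntegral_eq _ _ ?_ (hq a b) fun B hB _ => ?_
    · exact (Complex.conjCLE : ℂ →L[ℝ] ℂ).integrable_comp (hq b a)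
    · have := (h B hB).1.apply a b
      simp only [Matrix.of_apply] at this
      rw [← this, Complex.star_def, ← integral_conj]
  have hnn : ∀ᵐ x ∂τ, ∀ i : ℕ,
      0 ≤ (star (TopologicalSpace.denseSeq (n → ℂ) i) ⬝ᵥ
        q x *ᵥ (TopologicalSpace.denseSeq (n → ℂ) i)).re := by
    refine ae_all_iff.2 fun i => ?_
    set v := TopologicalSpace.denseSeq (n → ℂ) i
    simp only [← trace_mul_vecMulVec_star]
    have hi := integrable_trace_mul hq (Matrix.vecMulVec v (star v))
    refine ae_nonneg_of_forall_setIntegral_nonneg (Complex.reCLM.integrable_comp hi)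
      fun B hB _ => ?_
    have hre := ContinuousLinearMap.integral_comp_comm Complex.reCLM (hi.restrict (s := B))
    simp only [Complex.reCLM_apply] at hre
    rw [hre, integral_trace_mul fun a b => (hq a b).restrict, trace_mul_vecMulVec_star]
    exact (Complex.le_def.1 ((h B hB).dotProduct_mulVec_nonneg v)).1
  filter_upwards [hherm, hnn] with x h1 h2
  have hx : (q x).IsHermitian := by
    ext a b
    exact h1 a b
  refine Matrix.PosSemidef.of_dotProduct_mulVec_nonneg hx fun v => ?_
  have hre : 0 ≤ (star v ⬝ᵥ q x *ᵥ v).re := by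
    have hcl : IsClosed {w : n → ℂ | 0 ≤ (star w ⬝ᵥ q x *ᵥ w).re} := by
      refine isClosed_le continuous_const (Complex.continuous_re.comp ?_)
      exact Continuous.dotProduct continuous_star (continuous_const.matrix_mulVec continuous_id)
    exact (TopologicalSpace.denseRange_denseSeq (n → ℂ)).induction_on
      (p := fun w => 0 ≤ (star w ⬝ᵥ q x *ᵥ w).re) v hcl h2
  refine Complex.le_def.2 ⟨hre, ?_⟩
  have := hx.im_star_dotProduct_mulVec_self v
  exact this.symm

variable [DecidableEq n]

/-- The outcome distribution `τ` in the maximally mixed state dominates every entry: `τ B = 0`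
forces `Tr Q_B = 0`, hence `Q_B = 0` by positivity. Radon–Nikodym then applies to the real and
imaginary parts of the entries. -/
theorem POVM.exists_density [Nonempty n] (Q : POVM X n) :
    ∃ (τ : Measure X) (q : X → Matrix n n ℂ), IsProbabilityMeasure τ ∧
      (∀ a b, Measurable fun x => q x a b) ∧ (∀ a b, Integrable (fun x => q x a b) τ) ∧
      ∀ B, MeasurableSet B → ∀ a b, Q.toVectorMeasure B a b = ∫ x in B, q x a b ∂τ := by
  set τ := bornMeasure Q (State.maximallyMixed n) with hτ
  have hzero : ∀ B, MeasurableSet B → τ B = 0 → Q.toVectorMeasure B = 0 := by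
    intro B hB h0
    have hp := Q.posSemidef B
    rw [hτ, bornMeasure_apply _ _ hB, ENNReal.ofReal_eq_zero] at h0
    have h1 : (Q.toVectorMeasure B * (State.maximallyMixed n).mat).trace
        = (((Fintype.card n : ℝ)⁻¹ : ℝ) : ℂ) * (Q.toVectorMeasure B).trace := by
      simp [State.maximallyMixed]
    have hc : 0 < (Fintype.card n : ℝ)⁻¹ := by positivity
    rw [h1, Complex.re_ofReal_mul] at h0
    have h2 := Complex.le_def.1 hp.trace_nonneg
    rw [← hp.trace_eq_zero_iff]
    refine Complex.ext ?_ h2.2.symm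
    exact le_antisymm (nonpos_of_mul_nonpos_right h0 hc) h2.1
  let re : n → n → SignedMeasure X := fun a b => Q.toVectorMeasure.mapRange
    (Complex.reAddGroupHom.comp (Matrix.entryAddMonoidHom ℂ a b))
    (Complex.continuous_re.comp (continuous_id.matrix_elem a b))
  let im : n → n → SignedMeasure X := fun a b => Q.toVectorMeasure.mapRange
    (Complex.imAddGroupHom.comp (Matrix.entryAddMonoidHom ℂ a b))
    (Complex.continuous_im.comp (continuous_id.matrix_elem a b))
  have hre : ∀ a b B, re a b B = (Q.toVectorMeasure B a b).re := fun _ _ _ => rfl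
  have him : ∀ a b B, im a b B = (Q.toVectorMeasure B a b).im := fun _ _ _ => rfl
  choose f hfm hfi hf using fun a b => exists_setIntegral_eq_signedMeasure τ (re a b)
    fun B hB h0 => by rw [hre, hzero B hB h0]; rfl
  choose g hgm hgi hg using fun a b => exists_setIntegral_eq_signedMeasure τ (im a b)
    fun B hB h0 => by rw [him, hzero B hB h0]; rfl
  refine ⟨τ, fun x => Matrix.of fun a b => (f a b x : ℂ) + (g a b x : ℂ) * Complex.I,
    inferInstance, fun a b => ?_, fun a b => ?_, fun B hB a b => ?_⟩
  · exact (Complex.measurable_ofReal.comp (hfm a b)).add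
      ((Complex.measurable_ofReal.comp (hgm a b)).mul_const _)
  · exact (hfi a b).ofReal.add ((hgi a b).ofReal.mul_const _)
  · simp only [Matrix.of_apply]
    rw [integral_add (hfi a b).ofReal.restrict ((hgi a b).ofReal.mul_const _).restrict,
      integral_mul_const, integral_complex_ofReal, integral_complex_ofReal, ← hf a b B hB,
      ← hg a b B hB, hre, him, Complex.re_add_im]

theorem POVM.exists_eq_ofDensity [Nonempty n] (Q : POVM X n) :
    ∃ (τ : Measure X) (q : X → Matrix n n ℂ) (_ : IsProbabilityMeasure τ)
      (h : IsPOVMDensity τ q), Q = POVM.ofDensity h id measurable_id := by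
  obtain ⟨τ, q, hτ, hm, hi, hQ⟩ := Q.exists_density
  have h : IsPOVMDensity τ q :=
    { measurable := hm
      integrable := hi
      posSemidef := ae_posSemidef_of_setIntegral hi fun B hB => by
        convert! Q.posSemidef B
        ext a b
        rw [Matrix.of_apply, hQ B hB a b]
      integral_eq := fun a b => by
        rw [← setIntegral_univ, ← hQ _ MeasurableSet.univ, Q.univ_eq_one] }
  refine ⟨τ, q, hτ, h, ?_⟩
  have : Q.toVectorMeasure = (POVM.ofDensity h id measurable_id).toVectorMeasure := by
    refine VectorMeasure.ext fun B hB => ?_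
    rw [POVM.ofDensity_apply h measurable_id hB]
    ext a b
    exact hQ B hB a b
  cases Q
  cases hP : POVM.ofDensity h id measurable_id
  rw [hP] at this
  subst this
  rfl

end RadonNikodym

/-! ### Entrywise integrals of matrices -/

section EntryIntegral

variable {Z : Type*} [MeasurableSpace Z] {l m n o : Type*} [Fintype m] [Fintype n]

/-- The entrywise integral of a matrix-valued function. -/
def entryIntegral (τ : Measure Z) (X : Z → Matrix m n ℂ) : Matrix m n ℂ :=
  Matrix.of fun a b => ∫ z, X z a b ∂τ

theorem entryIntegral_mul_mul {τ : Measure Z} {X : Z → Matrix m n ℂ}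
    (hX : ∀ a b, Integrable (fun z => X z a b) τ) (L : Matrix l m ℂ) (R : Matrix n o ℂ) :
    entryIntegral τ (fun z => L * X z * R) = L * entryIntegral τ X * R := by
  ext i j
  simp only [entryIntegral, Matrix.of_apply, Matrix.mul_apply]
  rw [integral_finsetSum _ fun b _ => (integrable_finsetSum _ fun a _ =>
    (hX a b).const_mul _).mul_const _]
  refine Finset.sum_congr rfl fun b _ => ?_
  rw [integral_mul_const, integral_finsetSum _ fun a _ => (hX a b).const_mul _]
  congr 1
  exact Finset.sum_congr rfl fun a _ => integral_const_mul _ _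

end EntryIntegral

/-! ### Costs as nonnegative integrals -/

section Cost

theorem measurable_ofReal_cost_sub {G : Type*} [MeasurableSpace G] {c : G → G → ℝ}
    (hc : Measurable fun x : G × G => c x.1 x.2) (a : ℝ) (g : G) :
    Measurable fun x => ENNReal.ofReal (c x g - a) :=
  ((hc.comp (measurable_id.prodMk measurable_const)).sub measurable_const).ennreal_ofReal

variable {G : Type*} [Group G] [MeasurableSpace G] {n : Type*} [Fintype n] [DecidableEq n]
  {U : ProjUnitaryRep G n} {ρ : State n} {c : G → G → ℝ}

/-- Splitting off a lower bound of the cost leaves a `∫⁻`, to which Tonelli and translation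
invariance apply with no finiteness condition. -/
theorem condCost_eq_add {a : ℝ} (hc : Measurable fun x : G × G => c x.1 x.2)
    (ha : ∀ x g, a ≤ c x g) (P : POVM G n) (g : G) :
    condCost c U ρ P g = (a : EReal)
      + ((∫⁻ x, ENNReal.ofReal (c x g - a) ∂bornMeasure P (ρ.evolve U g) : ℝ≥0∞) : EReal) := by
  rw [← extIntegral_coe_add a (measurable_ofReal_cost_sub hc a g)]
  unfold condCost
  congr 1
  ext x
  rw [EReal.coe_ennreal_ofReal, max_eq_left (sub_nonneg.2 (ha x g)), ← EReal.coe_add]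
  simp

theorem averageCost_le_worstCaseCost (haar : Measure G)
    [IsProbabilityMeasure haar] (Q : POVM G n) :
    averageCost haar c U ρ Q ≤ worstCaseCost c U ρ Q :=
  extIntegral_le_of_le fun g => le_iSup (fun g => condCost c U ρ Q g) g

end Cost

/-! ### From a right transfer to a measurement of constant cost -/

section Transfer

/-- In this expansion `A` enters only through products of an entry with a conjugate entry, the only
functions of `h` that `IsRightTransfer` assumes measurable. -/
theorem sum_conjTranspose_mul_mul_apply {G n K R : Type*} [Fintype K] [Fintype R]
    (A : R → G → Matrix K n ℂ) (X : Matrix K K ℂ) (h : G) (a b : n) :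
    (∑ r, (A r h)ᴴ * X * A r h) a b
      = ∑ r, ∑ d, ∑ c, X c d * (A r h d b * star (A r h c a)) := by
  simp only [Matrix.sum_apply, Matrix.mul_apply, Matrix.conjTranspose_apply, Finset.sum_mul]
  refine Finset.sum_congr rfl fun r _ => Finset.sum_congr rfl fun d _ =>
    Finset.sum_congr rfl fun c _ => by ring

variable {G : Type*} [Group G] [MeasurableSpace G] {haar : Measure G}
  {n K R : Type*} [Fintype n] [DecidableEq n] [Fintype K] [DecidableEq K] [Fintype R]
  {U : ProjUnitaryRep G n} {V : ProjUnitaryRep G K} {ρ : State n} {σ : State K}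

/-- Kraus operators `A r h` that turn `U_g ρ U_gᴴ` into `V_{gh} σ V_{gh}ᴴ` and, together with an
operator `E` that annihilates the states `U_g ρ U_gᴴ`, resolve the identity on average over `h`. -/
structure IsRightTransfer (haar : Measure G) (U : ProjUnitaryRep G n) (V : ProjUnitaryRep G K)
    (ρ : State n) (σ : State K) (A : R → G → Matrix K n ℂ) (E : Matrix n n ℂ) : Prop where
  measurable : ∀ r a b c d, Measurable fun h => A r h a b * star (A r h c d)
  integrable : ∀ r a b c d, Integrable (fun h => A r h a b * star (A r h c d)) haar
  posSemidef : E.PosSemidef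
  mul_evolve : ∀ g, E * (ρ.evolve U g).mat = 0
  sum_eq : entryIntegral haar (fun h => ∑ r, (A r h)ᴴ * A r h) + E = 1
  transfer : ∀ g h, ∑ r, A r h * (ρ.evolve U g).mat * (A r h)ᴴ = (σ.evolve V (g * h)).mat

variable {A : R → G → Matrix K n ℂ} {E : Matrix n n ℂ}

/-- The Heisenberg form of `transfer`, by cyclicity of the trace; `E` drops out because it
annihilates the evolved states. -/
theorem IsRightTransfer.trace_mul_evolve (hA : IsRightTransfer haar U V ρ σ A E)
    (X : Matrix K K ℂ) (g h : G) :
    (((∑ r, (A r h)ᴴ * X * A r h) + E) * (ρ.evolve U g).mat).trace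
      = (X * (σ.evolve V (g * h)).mat).trace := by
  rw [add_mul, hA.mul_evolve, add_zero, ← hA.transfer g h, Finset.sum_mul, Matrix.trace_sum,
    Finset.mul_sum, Matrix.trace_sum]
  refine Finset.sum_congr rfl fun r _ => ?_
  rw [Matrix.mul_assoc, Matrix.mul_assoc, Matrix.trace_mul_comm]
  simp only [Matrix.mul_assoc]

variable [IsProbabilityMeasure haar] {c : G → G → ℝ}

/-- Integrating over the first variable replaces `q` by the identity, and the Haar mean of `∑ Aᴴ A`
is `1 - E`. The constant density `E` contributes exactly `E`, since both measures are probability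
measures. -/
theorem IsRightTransfer.isPOVMDensity (hA : IsRightTransfer haar U V ρ σ A E) {τ : Measure G}
    [IsProbabilityMeasure τ] {q : G → Matrix K K ℂ} (hq : IsPOVMDensity τ q) :
    IsPOVMDensity (τ.prod haar) fun z => (∑ r, (A r z.2)ᴴ * q z.1 * A r z.2) + E := by
  have hi : ∀ a b r d c, Integrable
      (fun z : G × G => q z.1 c d * (A r z.2 d b * star (A r z.2 c a))) (τ.prod haar) :=
    fun a b r d c => (hq.integrable c d).mul_prod (hA.integrable r d b c a)
  have hi2 : ∀ a b, Integrable
      (fun z : G × G => (∑ r, (A r z.2)ᴴ * q z.1 * A r z.2) a b) (τ.prod haar) := by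
    intro a b
    simp only [sum_conjTranspose_mul_mul_apply]
    exact integrable_finsetSum _ fun r _ => integrable_finsetSum _ fun d _ =>
      integrable_finsetSum _ fun c _ => hi a b r d c
  refine ⟨fun a b => ?_, fun a b => ?_, ?_, fun a b => ?_⟩
  · simp only [Matrix.add_apply, sum_conjTranspose_mul_mul_apply]
    refine Measurable.add (Finset.measurable_sum _ fun r _ => Finset.measurable_sum _ fun d _ =>
      Finset.measurable_sum _ fun c _ => ?_) measurable_const
    exact ((hq.measurable c d).comp measurable_fst).mul
      ((hA.measurable r d b c a).comp measurable_snd)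
  · simp only [Matrix.add_apply]
    exact (hi2 a b).add (integrable_const _)
  · have := Measure.quasiMeasurePreserving_fst (μ := τ) (ν := haar) |>.ae hq.posSemidef
    filter_upwards [this] with z hz
    exact (Matrix.posSemidef_sum _ fun r _ => hz.conjTranspose_mul_mul_same _).add hA.posSemidef
  · simp only [Matrix.add_apply]
    rw [integral_add (hi2 a b) (integrable_const _), ← hA.sum_eq, Matrix.add_apply]
    congr 1
    · have hone : ∀ h, (∑ r, (A r h)ᴴ * A r h) a b
          = ∑ r, ∑ d, ∑ c, (1 : Matrix K K ℂ) c d * (A r h d b * star (A r h c a)) := by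
        intro h
        rw [← sum_conjTranspose_mul_mul_apply]
        simp only [Matrix.mul_one]
      simp only [entryIntegral, Matrix.of_apply, hone, sum_conjTranspose_mul_mul_apply]
      have hj : ∀ r d c, Integrable
          (fun h => (1 : Matrix K K ℂ) c d * (A r h d b * star (A r h c a))) haar :=
        fun r d c => (hA.integrable r d b c a).const_mul _
      rw [integral_finsetSum _ fun r _ => integrable_finsetSum _ fun d _ =>
          integrable_finsetSum _ fun c _ => hi a b r d c,
        integral_finsetSum _ fun r _ => integrable_finsetSum _ fun d _ =>
          integrable_finsetSum _ fun c _ => hj r d c]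
      refine Finset.sum_congr rfl fun r _ => ?_
      rw [integral_finsetSum _ fun d _ => integrable_finsetSum _ fun c _ => hi a b r d c,
        integral_finsetSum _ fun d _ => integrable_finsetSum _ fun c _ => hj r d c]
      refine Finset.sum_congr rfl fun d _ => ?_
      rw [integral_finsetSum _ fun c _ => hi a b r d c, integral_finsetSum _ fun c _ => hj r d c]
      refine Finset.sum_congr rfl fun c _ => ?_
      rw [integral_prod_mul (μ := τ) (ν := haar) (fun x => q x c d)
        (fun h => A r h d b * star (A r h c a)), hq.integral_eq, integral_const_mul]
    · simp

theorem averageCost_and_worstCaseCost_le {P : POVM G n} {Q : POVM G K}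
    (h : ∀ g, condCost c U ρ P g = averageCost haar c V σ Q) :
    averageCost haar c U ρ P ≤ averageCost haar c V σ Q ∧
      worstCaseCost c U ρ P ≤ worstCaseCost c V σ Q :=
  ⟨extIntegral_le_of_le fun g => (h g).le,
    (iSup_le fun g => (h g).le).trans (averageCost_le_worstCaseCost haar Q)⟩

variable [Nonempty K]

theorem averageCost_eq_add {a : ℝ} (hc : Measurable fun x : G × G => c x.1 x.2)
    (ha : ∀ x g, a ≤ c x g) (hm : ∀ i j, Measurable fun g => (σ.evolve V g).mat i j)
    (Q : POVM G K) :
    averageCost haar c V σ Q = (a : EReal) + ((∫⁻ g, ∫⁻ x, ENNReal.ofReal (c x g - a)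
      ∂bornMeasure Q (σ.evolve V g) ∂haar : ℝ≥0∞) : EReal) := by
  rw [← extIntegral_coe_add a]
  · unfold averageCost
    simp only [condCost_eq_add hc ha]
  -- Measurability in `g` of the inner integral: its measure varies with `g`, but a density of `Q`
  -- rewrites it as the integral of a jointly measurable function against the fixed `τ`.
  · obtain ⟨τ, q, hτ, hq, rfl⟩ := Q.exists_eq_ofDensity
    simp only [lintegral_bornMeasure_ofDensity hq measurable_id _
      (measurable_ofReal_cost_sub hc a _), id]
    have h2 : Measurable fun z : G × G => (q z.1 * (σ.evolve V z.2).mat).trace := by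
      simp only [Matrix.trace, Matrix.diag, Matrix.mul_apply]
      exact Finset.measurable_sum _ fun i _ => Finset.measurable_sum _ fun j _ =>
        ((hq.measurable i j).comp measurable_fst).mul ((hm j i).comp measurable_snd)
    exact Measurable.lintegral_prod_left' (f := fun z : G × G =>
      ENNReal.ofReal (c z.1 z.2 - a) * ENNReal.ofReal (q z.1 * (σ.evolve V z.2).mat).trace.re)
      ((hc.sub measurable_const).ennreal_ofReal.mul
        (Complex.measurable_re.comp h2).ennreal_ofReal)

variable [MeasurableMul₂ G] [MeasurableInv G]

/-- A right transfer turns measurements of the states `V_{gh} σ V_{gh}ᴴ`, with `h` random and the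
outcome `x` processed to `x h⁻¹`, into a measurement of `U_g ρ U_gᴴ`. -/
theorem IsRightTransfer.exists_povm (hA : IsRightTransfer haar U V ρ σ A E) (Q : POVM G K) :
    ∃ P : POVM G n, ∀ (g : G) (f : G → ℝ≥0∞), Measurable f →
      ∫⁻ x, f x ∂bornMeasure P (ρ.evolve U g)
        = ∫⁻ h, ∫⁻ x, f (x * h⁻¹) ∂bornMeasure Q (σ.evolve V (g * h)) ∂haar := by
  obtain ⟨τ, q, hτ, hq, rfl⟩ := Q.exists_eq_ofDensity
  have hd := hA.isPOVMDensity hq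
  have ht : Measurable fun z : G × G => z.1 * z.2⁻¹ := measurable_fst.mul measurable_snd.inv
  refine ⟨POVM.ofDensity hd _ ht, fun g f hf => ?_⟩
  rw [lintegral_bornMeasure_ofDensity hd ht _ hf]
  have hm : Measurable fun z : G × G => f (z.1 * z.2⁻¹) * ENNReal.ofReal
      (((∑ r, (A r z.2)ᴴ * q z.1 * A r z.2) + E) * (ρ.evolve U g).mat).trace.re := (hf.comp ht).mul
    (Complex.measurable_re.comp (hd.measurable_trace_mul (ρ.evolve U g).mat)).ennreal_ofReal
  rw [lintegral_prod_symm _ hm.aemeasurable]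
  refine lintegral_congr fun h => ?_
  have hfh : Measurable fun x => f (x * h⁻¹) := hf.comp (measurable_id.mul measurable_const)
  rw [lintegral_bornMeasure_ofDensity hq measurable_id _ hfh]
  refine lintegral_congr fun x => ?_
  rw [hA.trace_mul_evolve]
  rfl

/-- For a right-invariant cost, a right transfer provides a measurement whose cost at every group
element is the given average cost. -/
theorem IsRightTransfer.exists_condCost_eq [haar.IsMulLeftInvariant]
    (hA : IsRightTransfer haar U V ρ σ A E) (hc : Measurable fun x : G × G => c x.1 x.2)
    (hmin : ∀ x g, c g g ≤ c x g) (hright : ∀ x g h, c (x * h) (g * h) = c x g)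
    (hm : ∀ i j, Measurable fun g => (σ.evolve V g).mat i j) (Q : POVM G K) :
    ∃ P : POVM G n, ∀ g, condCost c U ρ P g = averageCost haar c V σ Q := by
  obtain ⟨P, hP⟩ := hA.exists_povm Q
  -- Right invariance makes the cost constant on the diagonal, so `c 1 1` is its global minimum.
  have ha : ∀ x g, c 1 1 ≤ c x g := fun x g => by
    have := hright 1 1 g
    rw [one_mul] at this
    exact this ▸ hmin x g
  refine ⟨P, fun g => ?_⟩
  rw [condCost_eq_add hc ha, averageCost_eq_add hc ha hm]
  congr 2
  rw [hP g _ (measurable_ofReal_cost_sub hc (c 1 1) g)]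
  -- The identity `c(x h⁻¹, g) = c(x, gh)` makes the integrand a function of `gh` alone, and left
  -- invariance then removes `g`.
  refine Eq.trans ?_ (lintegral_mul_left_eq_self (μ := haar) (fun g => ∫⁻ x,
    ENNReal.ofReal (c x g - c 1 1) ∂bornMeasure Q (σ.evolve V g)) g)
  refine lintegral_congr fun h => lintegral_congr fun x => ?_
  have := hright (x * h⁻¹) g h
  rw [inv_mul_cancel_right] at this
  rw [this]

end Transfer

/-! ### Schur's lemma and Haar averages -/

section Schur

variable {G : Type*} [Group G] {n : Type*} [Fintype n] [DecidableEq n] {U : ProjUnitaryRep G n}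

/-- **Schur's lemma**: a matrix that commutes with an irreducible representation is scalar. -/
theorem ProjUnitaryRep.IsIrreducible.exists_eq_smul_one (hU : U.IsIrreducible)
    {X : Matrix n n ℂ} (hX : ∀ g, U.mat g * X = X * U.mat g) : ∃ c : ℂ, X = c • 1 := by
  obtain ⟨hn, hS⟩ := hU
  obtain ⟨c, hc⟩ := Module.End.exists_eigenvalue (Matrix.toLin' X)
  have hmem : ∀ v, v ∈ Module.End.eigenspace (Matrix.toLin' X) c ↔ X *ᵥ v = c • v := fun v => by
    rw [Module.End.mem_eigenspace_iff, Matrix.toLin'_apply]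
  have := hS (Module.End.eigenspace (Matrix.toLin' X) c) fun g v hv => by
    rw [hmem] at hv ⊢
    rw [Matrix.mulVec_mulVec, ← hX g, ← Matrix.mulVec_mulVec, hv, Matrix.mulVec_smul]
  refine ⟨c, ?_⟩
  rcases this with h | h
  · exact absurd h hc
  · refine Matrix.ext_of_mulVec_single fun i => ?_
    have : Pi.single i 1 ∈ Module.End.eigenspace (Matrix.toLin' X) c := h ▸ Submodule.mem_top
    rw [(hmem _).1 this, Matrix.smul_mulVec, Matrix.one_mulVec]

theorem ProjUnitaryRep.conjTranspose_mul_self (U : ProjUnitaryRep G n) (g : G) :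
    (U.mat g)ᴴ * U.mat g = 1 :=
  Matrix.mem_unitaryGroup_iff'.1 (U.mat_unitary g)

theorem ProjUnitaryRep.mul_conjTranspose_self (U : ProjUnitaryRep G n) (g : G) :
    U.mat g * (U.mat g)ᴴ = 1 :=
  Matrix.mem_unitaryGroup_iff.1 (U.mat_unitary g)

theorem ProjUnitaryRep.star_mult_mul_mult (U : ProjUnitaryRep G n) (g h : G) :
    star (U.mult g h) * U.mult g h = 1 := by
  rw [Complex.star_def, ← Complex.normSq_eq_conj_mul_self, Complex.normSq_eq_norm_sq, U.norm_mult]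
  simp

/-- The multiplier has modulus one and cancels under conjugation, so the channels form a genuine
action of `G`. -/
theorem ProjUnitaryRep.mul_conj_mul (U : ProjUnitaryRep G n) (g h : G) (X : Matrix n n ℂ) :
    U.mat g * (U.mat h * X * (U.mat h)ᴴ) * (U.mat g)ᴴ
      = U.mat (g * h) * X * (U.mat (g * h))ᴴ := by
  have h1 : U.mat g * (U.mat h * X * (U.mat h)ᴴ) * (U.mat g)ᴴ
      = (U.mat g * U.mat h) * X * (U.mat g * U.mat h)ᴴ := by
    rw [Matrix.conjTranspose_mul]
    simp only [mul_assoc]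
  rw [h1, U.mat_mul, Matrix.conjTranspose_smul, Matrix.smul_mul, Matrix.smul_mul, Matrix.mul_smul,
    smul_smul, mul_comm, U.star_mult_mul_mult, one_smul]

variable [MeasurableSpace G] [MeasurableMul G] {haar : Measure G} [IsProbabilityMeasure haar]
  [haar.IsMulLeftInvariant]

/-- The Haar average of `U_h X U_hᴴ` over an irreducible representation is scalar. -/
theorem ProjUnitaryRep.IsIrreducible.entryIntegral_conj (hU : U.IsIrreducible)
    (X : Matrix n n ℂ)
    (hi : ∀ a b, Integrable (fun h => (U.mat h * X * (U.mat h)ᴴ) a b) haar) :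
    entryIntegral haar (fun h => U.mat h * X * (U.mat h)ᴴ)
      = (X.trace / Fintype.card n) • 1 := by
  set Y := entryIntegral haar (fun h => U.mat h * X * (U.mat h)ᴴ) with hY
  have hconj : ∀ g, U.mat g * Y * (U.mat g)ᴴ = Y := by
    intro g
    rw [hY, ← entryIntegral_mul_mul hi]
    ext a b
    simp only [U.mul_conj_mul]
    exact integral_mul_left_eq_self (μ := haar) (fun h => (U.mat h * X * (U.mat h)ᴴ) a b) g
  obtain ⟨c, hc⟩ := hU.exists_eq_smul_one (X := Y) fun g => by
    conv_rhs => rw [← hconj g]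
    rw [mul_assoc _ _ (U.mat g), U.conjTranspose_mul_self, mul_one]
  -- Every unitary conjugation preserves the trace, and this determines the scalar.
  have htr : Y.trace = X.trace := by
    simp only [Matrix.trace, Matrix.diag, hY, entryIntegral, Matrix.of_apply]
    rw [← integral_finsetSum _ fun a _ => hi a a]
    have : ∀ h, ∑ a, (U.mat h * X * (U.mat h)ᴴ) a a = X.trace := fun h => by
      have h1 : ∑ a, (U.mat h * X * (U.mat h)ᴴ) a a = (U.mat h * X * (U.mat h)ᴴ).trace := rfl
      rw [h1, Matrix.trace_mul_comm, ← mul_assoc, U.conjTranspose_mul_self, one_mul]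
    simp only [this]
    simp [Matrix.trace]
  have hn : Nonempty n := hU.1
  have hcard : (Fintype.card n : ℂ) ≠ 0 := by simp
  rw [← htr, hc, Matrix.trace_smul, Matrix.trace_one, smul_eq_mul, mul_div_cancel_right₀ _ hcard]

end Schur

/-! ### Functions spanned by matrix entries -/

section EntrySpan

variable {G : Type*} [Group G] {n : Type*} [Fintype n] [DecidableEq n]

/-- The functions on `G` spanned by the matrix entries of a representation. -/
def ProjUnitaryRep.entrySpan (U : ProjUnitaryRep G n) : Submodule ℂ (G → ℂ) :=
  Submodule.span ℂ (Set.range fun ab : n × n => fun h => U.mat h ab.1 ab.2)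

variable {U : ProjUnitaryRep G n}

theorem ProjUnitaryRep.mat_mem_entrySpan (a b : n) : (fun h => U.mat h a b) ∈ U.entrySpan :=
  Submodule.subset_span ⟨(a, b), rfl⟩

theorem mul_mul_mem_of_forall_mem {X : Type*} {S : Submodule ℂ (X → ℂ)} {l m o p : Type*}
    [Fintype m] [Fintype o] {M : X → Matrix m o ℂ} (hM : ∀ a b, (fun x => M x a b) ∈ S)
    (L : Matrix l m ℂ) (R : Matrix o p ℂ) (i : l) (j : p) :
    (fun x => (L * M x * R) i j) ∈ S := by
  have : (fun x => (L * M x * R) i j)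
      = ∑ b, R b j • ∑ a, L i a • fun x => M x a b := by
    ext x
    simp only [Matrix.mul_apply, Finset.sum_apply, Pi.smul_apply, smul_eq_mul]
    exact Finset.sum_congr rfl fun b _ => mul_comm _ _
  rw [this]
  exact S.sum_mem fun b _ => S.smul_mem _ (S.sum_mem fun a _ => S.smul_mem _ (hM a b))

variable [TopologicalSpace G]

/-- The phase of `U_h` cancels in `u * star v`. For two matrix entries the product is an entry of
`U_h A U_hᴴ` with `A` a matrix unit; sesquilinearity extends this to the span. Continuity for the
Kraus operators and for the irreducible components rests on it. -/
theorem ProjUnitaryRep.IsContinuous.continuous_mul_star (hU : U.IsContinuous) {u v : G → ℂ}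
    (hu : u ∈ U.entrySpan) (hv : v ∈ U.entrySpan) : Continuous fun h => u h * star (v h) := by
  unfold ProjUnitaryRep.entrySpan at hu hv
  induction hu, hv using Submodule.span_induction₂ with
  | mem_mem u v hu hv =>
    obtain ⟨⟨a, b⟩, rfl⟩ := hu
    obtain ⟨⟨c, d⟩, rfl⟩ := hv
    have := (hU (Matrix.single b d 1)).matrix_elem a c
    convert! this using 2 with h
    simp [Matrix.mul_apply, Matrix.single_apply, ite_and]
  | zero_left => simpa using continuous_const
  | zero_right => simpa using continuous_const
  | add_left u₁ u₂ v _ _ _ h1 h2 => exact (h1.add h2).congr fun x => by simp [add_mul]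
  | add_right u v₁ v₂ _ _ _ h1 h2 => exact (h1.add h2).congr fun x => by simp [mul_add]
  | smul_left r u v _ _ h => exact (h.const_smul r).congr fun x => by simp [mul_assoc]
  | smul_right r u v _ _ h => exact (h.const_smul (star r)).congr fun x => by simp [mul_left_comm]

theorem ProjUnitaryRep.IsContinuous.continuous_evolve (hU : U.IsContinuous) (ρ : State n)
    (i j : n) : Continuous fun g => (ρ.evolve U g).mat i j :=
  (hU ρ.mat).matrix_elem i j

theorem ProjUnitaryRep.IsContinuous.withAncilla (hU : U.IsContinuous) (κ : Type*) [Fintype κ]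
    [DecidableEq κ] : (U.withAncilla κ).IsContinuous := by
  intro A
  refine continuous_matrix fun i j => ?_
  have hmem : ∀ a b, (fun h => (U.withAncilla κ).mat h a b) ∈ U.entrySpan := by
    intro a b
    have : (fun h => (U.withAncilla κ).mat h a b)
        = (1 : Matrix κ κ ℂ) a.2 b.2 • fun h => U.mat h a.1 b.1 := by
      ext h
      simp [ProjUnitaryRep.withAncilla, Matrix.kroneckerMap_apply, mul_comm]
    rw [this]
    exact U.entrySpan.smul_mem _ (ProjUnitaryRep.mat_mem_entrySpan _ _)
  simp only [Matrix.mul_apply, Matrix.conjTranspose_apply, Finset.sum_mul]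
  refine continuous_finsetSum _ fun x _ => continuous_finsetSum _ fun y _ => ?_
  refine ((hU.continuous_mul_star (hmem i y) (hmem j x)).mul
    (continuous_const (y := A y x))).congr fun h => ?_
  simp only [Pi.mul_apply]
  ring

end EntrySpan

/-! ### Measurability of continuous functions -/

section Measurability

variable {G : Type*} [TopologicalSpace G] [MeasurableSpace G]

/-- Passing to real and imaginary parts uses only real continuous functions, which is all that a
Baire σ-algebra provides. -/
theorem measurable_of_continuous_complex (hG : ∀ f : G → ℝ, Continuous f → Measurable f)
    {f : G → ℂ} (hf : Continuous f) : Measurable f := by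
  have h := (Complex.measurable_ofReal.comp (hG _ (Complex.continuous_re.comp hf))).add
    ((Complex.measurable_ofReal.comp (hG _ (Complex.continuous_im.comp hf))).mul_const Complex.I)
  convert! h using 1
  ext x
  simp

theorem integrable_of_continuous_complex [CompactSpace G]
    (hG : ∀ f : G → ℝ, Continuous f → Measurable f)
    {f : G → ℂ} (hf : Continuous f) (τ : Measure G) [IsFiniteMeasure τ] : Integrable f τ := by
  obtain ⟨C, hC⟩ := isCompact_univ.exists_bound_of_continuousOn hf.continuousOn
  exact Integrable.of_bound (measurable_of_continuous_complex hG hf).aestronglyMeasurable C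
    (ae_of_all _ fun x => hC x (Set.mem_univ x))

end Measurability

/-! ### The Kraus operators and their action on the class vector -/

theorem sum_fin_dite_lt {M : Type*} [AddCommMonoid M] {d m : ℕ} (hdm : d ≤ m) (f : Fin d → M) :
    ∑ j : Fin m, (if h : (j : ℕ) < d then f ⟨j, h⟩ else 0) = ∑ i, f i := by
  symm
  refine Fintype.sum_of_injective (Fin.castLE hdm) (Fin.castLE_injective hdm) _ _
    (fun j hj => dif_neg fun h => hj ⟨⟨j, h⟩, rfl⟩) fun i => ?_
  rw [dif_pos (by simp)]
  rfl

theorem blockDiagonal'_mulVec {ι : Type*} [Fintype ι] [DecidableEq ι] {a b : ι → Type*}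
    [∀ i, Fintype (b i)] (M : ∀ i, Matrix (a i) (b i) ℂ) (v : (Σ i, b i) → ℂ) (i : ι) (x : a i) :
    (Matrix.blockDiagonal' M *ᵥ v) ⟨i, x⟩ = (M i *ᵥ fun y => v ⟨i, y⟩) x := by
  rw [Matrix.mulVec, dotProduct, Fintype.sum_sigma, Finset.sum_eq_single i]
  · simp [Matrix.mulVec, dotProduct]
  · intro j _ hj
    simp [Matrix.blockDiagonal'_apply_ne _ _ _ hj.symm]
  · simp

section KrausBlock

variable {d m : ℕ} {κ R : Type*} [Fintype κ] [Fintype R]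

/-- The operator on `ℂ^m` that sends the `j`-th basis vector, for `j < d`, to `s` times a part of
the `j`-th row of `M`, and annihilates the other basis vectors. -/
def krausBlock (s : ℝ) (M : Matrix (Fin d) (Fin m × κ × R) ℂ) (t : κ) (r : R) :
    Matrix (Fin m) (Fin m) ℂ :=
  Matrix.of fun j j' => if h : (j' : ℕ) < d then (s : ℂ) * M ⟨j', h⟩ (j, t, r) else 0

/-- The sum over `t`, `r` and the output index contracts the whole long index of `M`, leaving `M
Mᴴ`. The indices `j₁`, `j₂` come out exchanged because `krausBlock` is built from the transpose of
`M`. -/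
theorem sum_krausBlock_conjTranspose_mul_self (s : ℝ) (M : Matrix (Fin d) (Fin m × κ × R) ℂ)
    (j₁ j₂ : Fin m) :
    (∑ r, ∑ t, (krausBlock s M t r)ᴴ * krausBlock s M t r) j₁ j₂
      = if h₁ : (j₁ : ℕ) < d then if h₂ : (j₂ : ℕ) < d then
          (s * s : ℂ) * (M * Mᴴ) ⟨j₂, h₂⟩ ⟨j₁, h₁⟩ else 0 else 0 := by
  simp only [Matrix.sum_apply, Matrix.mul_apply, Matrix.conjTranspose_apply, krausBlock,
    Matrix.of_apply]
  by_cases h₁ : (j₁ : ℕ) < d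
  · by_cases h₂ : (j₂ : ℕ) < d
    · simp only [h₁, h₂, dif_pos, Fintype.sum_prod_type]
      rw [Finset.sum_comm, Finset.mul_sum]
      simp only [Finset.mul_sum]
      rw [Finset.sum_comm]
      refine (Finset.sum_congr rfl fun r _ => Finset.sum_comm).trans ?_
      rw [Finset.sum_comm]
      refine Finset.sum_congr rfl fun j _ => ?_
      rw [Finset.sum_comm]
      refine Finset.sum_congr rfl fun t _ => Finset.sum_congr rfl fun r _ => ?_
      simp only [star_mul', Complex.star_def, Complex.conj_ofReal]
      ring
    · simp [h₂]
  · simp [h₁]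

end KrausBlock

namespace IsotypicDecomposition

variable {G : Type*} [Group G] {n : Type*} [Fintype n] [DecidableEq n] {U : ProjUnitaryRep G n}
  (D : IsotypicDecomposition U)

/-- The matrix of `U_g` in the adapted basis. -/
def coordMat (g : G) :
    Matrix (Σ μ, Fin (D.d μ) × Fin (D.m μ)) (Σ μ, Fin (D.d μ) × Fin (D.m μ)) ℂ :=
  Matrix.blockDiagonal' fun μ =>
    (D.irrep μ).mat g ⊗ₖ (1 : Matrix (Fin (D.m μ)) (Fin (D.m μ)) ℂ)

/-- As `m_μ ≥ 1`, the entries of `U^μ_h` occur among those of `U_h` in the adapted basis. -/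
theorem irrep_mat_mem_entrySpan (μ : D.Irr) (i j : Fin (D.d μ)) :
    (fun h => (D.irrep μ).mat h i j) ∈ U.entrySpan := by
  have h0 := D.m_pos μ
  have : (fun h => (D.irrep μ).mat h i j)
      = fun h => (D.basisᴴ * U.mat h * D.basis) ⟨μ, (i, ⟨0, h0⟩)⟩ ⟨μ, (j, ⟨0, h0⟩)⟩ := by
    ext h
    have h1 : D.basisᴴ * U.mat h * D.basis = D.coordMat h := by
      rw [D.mat_eq h]
      simp only [Matrix.mul_assoc, D.conjTranspose_mul_basis, Matrix.mul_one]
      rw [← Matrix.mul_assoc, D.conjTranspose_mul_basis, Matrix.one_mul]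
      rfl
    rw [h1, coordMat, Matrix.blockDiagonal'_apply_eq]
    simp [Matrix.kroneckerMap_apply]
  rw [this]
  exact mul_mul_mem_of_forall_mem (fun a b => ProjUnitaryRep.mat_mem_entrySpan a b) _ _ _ _

theorem mat_mulVec_classVec (p : D.Irr → ℝ) (g : G) :
    U.mat g *ᵥ D.classVec p = D.basis *ᵥ (D.coordMat g *ᵥ D.classCoord p) := by
  rw [classVec, D.mat_eq g, Matrix.mulVec_mulVec, Matrix.mulVec_mulVec, Matrix.mul_assoc,
    D.conjTranspose_mul_basis, Matrix.mul_one]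
  rfl

/-- This is `(U ⊗ I)|I⟩⟩ = |U⟩⟩`: the second tensor factor records the column index of `U^μ_g`, and
its coordinates beyond `d_μ` stay empty. -/
theorem coordMat_mulVec_classCoord (p : D.Irr → ℝ) (g : G) (μ : D.Irr) (i : Fin (D.d μ))
    (j : Fin (D.m μ)) :
    (D.coordMat g *ᵥ D.classCoord p) ⟨μ, (i, j)⟩
      = if h : (j : ℕ) < D.d μ then
          ((√(p μ / D.d μ) : ℝ) : ℂ) * (D.irrep μ).mat g i ⟨j, h⟩ else 0 := by
  rw [coordMat, blockDiagonal'_mulVec, Matrix.mulVec, dotProduct, Fintype.sum_prod_type]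
  simp only [Matrix.kroneckerMap_apply, classCoord, Matrix.one_apply]
  split_ifs with h
  · rw [Finset.sum_eq_single ⟨j, h⟩]
    · rw [Finset.sum_eq_single j]
      · simp [mul_comm]
      · intro b _ hb
        simp [hb.symm]
      · simp
    · intro b _ hb
      have : (b : ℕ) ≠ j := fun h' => hb (Fin.ext h')
      refine Finset.sum_eq_zero fun x _ => ?_
      by_cases hx : j = x
      · subst hx; simp [this]
      · simp [hx]
    · simp
  · refine Finset.sum_eq_zero fun b _ => Finset.sum_eq_zero fun x _ => ?_
    by_cases hx : j = x
    · subst hx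
      have : (b : ℕ) ≠ j := fun h' => h (h' ▸ b.2)
      simp [this]
    · simp [hx]

section Kraus

variable {κ R : Type*} [Fintype κ] [DecidableEq κ] [Fintype R]

/-- The adapted basis of `H ⊗ ℂ^κ`. -/
def ancillaBasis (κ : Type*) [DecidableEq κ] :
    Matrix (n × κ) ((Σ μ, Fin (D.d μ) × Fin (D.m μ)) × κ) ℂ :=
  D.basis ⊗ₖ (1 : Matrix κ κ ℂ)

theorem conjTranspose_mul_ancillaBasis : (D.ancillaBasis κ)ᴴ * D.ancillaBasis κ = 1 := by
  rw [ancillaBasis, Matrix.conjTranspose_kronecker, ← Matrix.mul_kronecker_mul,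
    D.conjTranspose_mul_basis, Matrix.conjTranspose_one, Matrix.one_mul, Matrix.one_kronecker_one]

theorem ancillaBasis_mul_conjTranspose : D.ancillaBasis κ * (D.ancillaBasis κ)ᴴ = 1 := by
  rw [ancillaBasis, Matrix.conjTranspose_kronecker, ← Matrix.mul_kronecker_mul,
    D.basis_mul_conjTranspose, Matrix.conjTranspose_one, Matrix.one_mul, Matrix.one_kronecker_one]

theorem withAncilla_mat_eq (g : G) :
    (U.withAncilla κ).mat g
      = D.ancillaBasis κ * (D.coordMat g ⊗ₖ (1 : Matrix κ κ ℂ)) * (D.ancillaBasis κ)ᴴ := by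
  rw [ancillaBasis, Matrix.conjTranspose_kronecker, ← Matrix.mul_kronecker_mul,
    ← Matrix.mul_kronecker_mul, Matrix.conjTranspose_one, Matrix.one_mul, Matrix.one_mul]
  exact congrArg (· ⊗ₖ (1 : Matrix κ κ ℂ)) (D.mat_eq g)

/-- The block `μ` of the vectors of `H ⊗ ℂ^κ` that are the columns of `C`. -/
def blockRows (C : Matrix (n × κ) R ℂ) (μ : D.Irr) :
    Matrix (Fin (D.d μ)) (Fin (D.m μ) × κ × R) ℂ :=
  Matrix.of fun i y => ((D.ancillaBasis κ)ᴴ * C) (⟨μ, (i, y.1)⟩, y.2.1) y.2.2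

/-- The weight of the block `μ` in the operator `C Cᴴ`. -/
def weight (C : Matrix (n × κ) R ℂ) (μ : D.Irr) : ℝ :=
  (D.blockRows C μ * (D.blockRows C μ)ᴴ).trace.re

theorem trace_blockRows (C : Matrix (n × κ) R ℂ) (μ : D.Irr) :
    (D.blockRows C μ * (D.blockRows C μ)ᴴ).trace = (D.weight C μ : ℂ) := by
  have := (Matrix.posSemidef_self_mul_conjTranspose (D.blockRows C μ)).trace_nonneg
  exact Complex.ext rfl (Complex.le_def.1 this).2.symm

theorem weight_nonneg (C : Matrix (n × κ) R ℂ) (μ : D.Irr) : 0 ≤ D.weight C μ :=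
  (Complex.le_def.1
    (Matrix.posSemidef_self_mul_conjTranspose (D.blockRows C μ)).trace_nonneg).1

/-- Handles the blocks with `p_μ = 0`: there `√(d_μ / p_μ)` takes the default value `0`, and nothing
is lost because `C` has no component in the block. -/
theorem blockRows_eq_zero {C : Matrix (n × κ) R ℂ} {μ : D.Irr} (h : D.weight C μ = 0) :
    D.blockRows C μ = 0 := by
  have h1 := D.trace_blockRows C μ
  rw [h, Complex.ofReal_zero, Matrix.trace_mul_conjTranspose_self_eq_zero_iff] at h1
  exact h1

theorem sum_weight {C : Matrix (n × κ) R ℂ} (hC : (C * Cᴴ).trace = 1) :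
    ∑ μ, D.weight C μ = 1 := by
  set X := (D.ancillaBasis κ)ᴴ * C with hX
  have h1 : (X * Xᴴ).trace = 1 := by
    rw [hX, Matrix.conjTranspose_mul, Matrix.conjTranspose_conjTranspose, Matrix.mul_assoc,
      Matrix.trace_mul_comm, Matrix.mul_assoc, Matrix.mul_assoc, D.ancillaBasis_mul_conjTranspose,
      Matrix.mul_one, hC]
  have h2 : (X * Xᴴ).trace = ∑ μ, (D.weight C μ : ℂ) := by
    have hb : ∀ μ, D.blockRows C μ = Matrix.of fun i y => X (⟨μ, (i, y.1)⟩, y.2.1) y.2.2 :=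
      fun _ => rfl
    clear_value X
    simp only [← trace_blockRows, hb]
    simp only [Matrix.trace, Matrix.diag, Matrix.mul_apply, Matrix.conjTranspose_apply,
      Fintype.sum_prod_type, Fintype.sum_sigma, Matrix.of_apply]
  rw [h1] at h2
  exact_mod_cast h2.symm

/-- The Kraus operators in the adapted bases. -/
def krausCoord (C : Matrix (n × κ) R ℂ) (r : R) (h : G) :
    Matrix ((Σ μ, Fin (D.d μ) × Fin (D.m μ)) × κ) (Σ μ, Fin (D.d μ) × Fin (D.m μ)) ℂ :=
  Matrix.of fun y x => Matrix.blockDiagonal' (fun μ =>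
    (1 : Matrix (Fin (D.d μ)) (Fin (D.d μ)) ℂ) ⊗ₖ krausBlock (√(D.d μ / D.weight C μ))
      ((D.irrep μ).mat h * D.blockRows C μ) y.2 r) y.1 x

/-- The Kraus operators `⨁_μ √(d_μ / p_μ) I ⊗ (U_h Ψ_μ)ᵀ`, with values in `H ⊗ ℂ^κ`. -/
def kraus (C : Matrix (n × κ) R ℂ) (r : R) (h : G) : Matrix (n × κ) n ℂ :=
  D.ancillaBasis κ * D.krausCoord C r h * D.basisᴴ

theorem kraus_mem_entrySpan (C : Matrix (n × κ) R ℂ) (r : R) (a : n × κ) (b : n) :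
    (fun h => D.kraus C r h a b) ∈ U.entrySpan := by
  refine mul_mul_mem_of_forall_mem (M := fun h => D.krausCoord C r h) ?_ _ _ _ _
  rintro ⟨⟨μ, i, j⟩, t⟩ ⟨ν, i', j'⟩
  by_cases hμ : μ = ν
  · subst hμ
    simp only [krausCoord, Matrix.of_apply, Matrix.blockDiagonal'_apply_eq,
      Matrix.kroneckerMap_apply, krausBlock]
    by_cases hj : (j' : ℕ) < D.d μ
    · have h1 := mul_mul_mem_of_forall_mem (fun a b => D.irrep_mat_mem_entrySpan μ a b)
        (1 : Matrix (Fin (D.d μ)) (Fin (D.d μ)) ℂ) (D.blockRows C μ) ⟨j', hj⟩ (j, t, r)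
      simp only [Matrix.one_mul] at h1
      simp only [hj, dif_pos, ← mul_assoc]
      exact U.entrySpan.smul_mem _ h1
    · simp only [hj, dif_neg, not_false_eq_true, mul_zero]
      exact U.entrySpan.zero_mem
  · simp only [krausCoord, Matrix.of_apply, Matrix.blockDiagonal'_apply_ne _ _ _ hμ]
    exact U.entrySpan.zero_mem

/-- In each block the factors `√(d_μ / p_μ)` and `√(p_μ / d_μ)` cancel, leaving the matrix product
`U^μ_g (U^μ_h Ψ_μ)`, so `h` is placed to the right of `g`. The condition `d_μ ≤ m_μ` ensures that
all columns of `U^μ_g` are present in the class vector. -/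
theorem krausCoord_mulVec (hdm : ∀ μ, D.d μ ≤ D.m μ) (C : Matrix (n × κ) R ℂ) (r : R)
    (g h : G) :
    D.krausCoord C r h *ᵥ (D.coordMat g *ᵥ D.classCoord (D.weight C))
      = ((D.coordMat g * D.coordMat h) ⊗ₖ (1 : Matrix κ κ ℂ)) *ᵥ
        ((D.ancillaBasis κ)ᴴ * C).col r := by
  ext ⟨⟨μ, i, j⟩, t⟩
  have hL : (D.krausCoord C r h *ᵥ (D.coordMat g *ᵥ D.classCoord (D.weight C))) (⟨μ, i, j⟩, t)
      = ((D.irrep μ).mat g * ((D.irrep μ).mat h * D.blockRows C μ)) i (j, t, r) := by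
    have h0 : (D.krausCoord C r h *ᵥ (D.coordMat g *ᵥ D.classCoord (D.weight C))) (⟨μ, i, j⟩, t)
      = (Matrix.blockDiagonal' (fun μ =>
        (1 : Matrix (Fin (D.d μ)) (Fin (D.d μ)) ℂ) ⊗ₖ krausBlock (√(D.d μ / D.weight C μ))
        ((D.irrep μ).mat h * D.blockRows C μ) t r) *ᵥ
          (D.coordMat g *ᵥ D.classCoord (D.weight C))) ⟨μ, i, j⟩ := rfl
    rw [h0, blockDiagonal'_mulVec, Matrix.mulVec, dotProduct, Fintype.sum_prod_type,
      Finset.sum_eq_single i]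
    · simp only [Matrix.kroneckerMap_apply, Matrix.one_apply_eq, one_mul,
        coordMat_mulVec_classCoord, krausBlock, Matrix.of_apply]
      rw [Matrix.mul_apply, ← sum_fin_dite_lt (hdm μ)]
      refine Finset.sum_congr rfl fun j' _ => ?_
      split_ifs with hj
      · by_cases hw : D.weight C μ = 0
        · simp [D.blockRows_eq_zero hw]
        · have hd : (D.d μ : ℝ) ≠ 0 :=
            Nat.cast_ne_zero.2 (Fin.pos_iff_nonempty.2 (D.irreducible μ).1).ne'
          have hs : ((√(D.d μ / D.weight C μ) : ℝ) : ℂ) * ((√(D.weight C μ / D.d μ) : ℝ) : ℂ)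
              = 1 := by
            rw [← Complex.ofReal_mul, ← Real.sqrt_mul (by
              have := D.weight_nonneg C μ; positivity), div_mul_div_cancel₀ hw, div_self hd]
            simp
          linear_combination ((D.irrep μ).mat h * D.blockRows C μ) ⟨j', hj⟩ (j, t, r)
            * (D.irrep μ).mat g i ⟨j', hj⟩ * hs
      · simp
    · intro b _ hb
      simp [Matrix.one_apply_ne hb.symm]
    · simp
  rw [hL, ← Matrix.mul_assoc]
  have hmul : D.coordMat g * D.coordMat h = Matrix.blockDiagonal' fun μ =>
      ((D.irrep μ).mat g * (D.irrep μ).mat h) ⊗ₖ (1 : Matrix (Fin (D.m μ)) (Fin (D.m μ)) ℂ) := by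
    rw [coordMat, coordMat, ← Matrix.blockDiagonal'_mul]
    simp only [← Matrix.mul_kronecker_mul, Matrix.one_mul]
  have hR : (((D.coordMat g * D.coordMat h) ⊗ₖ (1 : Matrix κ κ ℂ)) *ᵥ
        ((D.ancillaBasis κ)ᴴ * C).col r) (⟨μ, i, j⟩, t)
      = ((D.coordMat g * D.coordMat h) *ᵥ
        fun x => ((D.ancillaBasis κ)ᴴ * C) (x, t) r) ⟨μ, i, j⟩ := by
    simp only [Matrix.mulVec, dotProduct, Fintype.sum_prod_type, Matrix.kroneckerMap_apply,
      Matrix.col_apply]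
    refine Finset.sum_congr rfl fun x _ => ?_
    rw [Finset.sum_eq_single t]
    · simp
    · intro b _ hb
      simp [Matrix.one_apply_ne hb.symm]
    · simp
  rw [hR, hmul, blockDiagonal'_mulVec, Matrix.mulVec, dotProduct, Fintype.sum_prod_type,
    Matrix.mul_apply]
  refine Finset.sum_congr rfl fun l _ => ?_
  rw [Finset.sum_eq_single j]
  · simp [blockRows]
  · intro b _ hb
    simp [Matrix.one_apply_ne hb.symm]
  · simp

theorem kraus_mulVec (hdm : ∀ μ, D.d μ ≤ D.m μ) (C : Matrix (n × κ) R ℂ) (r : R)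
    (g h : G) :
    D.kraus C r h *ᵥ (U.mat g *ᵥ D.classVec (D.weight C))
      = ((U.withAncilla κ).mat g * (U.withAncilla κ).mat h) *ᵥ C.col r := by
  have h2 : D.kraus C r h *ᵥ (D.basis *ᵥ (D.coordMat g *ᵥ D.classCoord (D.weight C)))
      = D.ancillaBasis κ *ᵥ (D.krausCoord C r h *ᵥ
        (D.coordMat g *ᵥ D.classCoord (D.weight C))) := by
    rw [kraus, Matrix.mulVec_mulVec, Matrix.mul_assoc, D.conjTranspose_mul_basis, Matrix.mul_one,
      ← Matrix.mulVec_mulVec]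
  have h3 : ((D.ancillaBasis κ)ᴴ * C).col r = (D.ancillaBasis κ)ᴴ *ᵥ C.col r := rfl
  rw [mat_mulVec_classVec, h2, D.krausCoord_mulVec hdm, h3,
    D.withAncilla_mat_eq g, D.withAncilla_mat_eq h, Matrix.mulVec_mulVec, Matrix.mulVec_mulVec]
  congr 1
  rw [← Matrix.one_mul (1 : Matrix κ κ ℂ), Matrix.mul_kronecker_mul, Matrix.one_mul]
  simp only [Matrix.mul_assoc]
  rw [← Matrix.mul_assoc (D.ancillaBasis κ)ᴴ (D.ancillaBasis κ),
    D.conjTranspose_mul_ancillaBasis, Matrix.one_mul]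

end Kraus

end IsotypicDecomposition

/-! ### Resolution of the identity and the right transfer from a class state -/

theorem sum_vecMulVec_col {m R : Type*} [Fintype R] (C : Matrix m R ℂ) :
    ∑ r, Matrix.vecMulVec (C.col r) (star (C.col r)) = C * Cᴴ := by
  ext a b
  simp [Matrix.sum_apply, Matrix.vecMulVec_apply, Matrix.mul_apply]

namespace IsotypicDecomposition

variable {G : Type*} [Group G] {n : Type*} [Fintype n] [DecidableEq n] {U : ProjUnitaryRep G n}
  (D : IsotypicDecomposition U) {κ R : Type*} [Fintype κ] [DecidableEq κ] [Fintype R]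

/-- The projection onto the orthogonal complement of the space `⨁_μ H_μ ⊗ H_μ`, the sum being over
those `μ` with `p_μ ≠ 0`. -/
def remainder (p : D.Irr → ℝ) : Matrix n n ℂ :=
  D.basis * Matrix.diagonal (fun x : Σ μ, Fin (D.d μ) × Fin (D.m μ) =>
    if (x.2.2 : ℕ) < D.d x.1 ∧ p x.1 ≠ 0 then (0 : ℂ) else 1) * D.basisᴴ

theorem posSemidef_remainder (p : D.Irr → ℝ) : (D.remainder p).PosSemidef := by
  refine Matrix.PosSemidef.mul_mul_conjTranspose_same (Matrix.PosSemidef.diagonal fun x => ?_) _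
  split_ifs <;> simp

theorem remainder_mulVec (p : D.Irr → ℝ) (g : G) :
    D.remainder p *ᵥ (U.mat g *ᵥ D.classVec p) = 0 := by
  rw [mat_mulVec_classVec, remainder, Matrix.mulVec_mulVec, Matrix.mul_assoc,
    D.conjTranspose_mul_basis, Matrix.mul_one, ← Matrix.mulVec_mulVec]
  convert! Matrix.mulVec_zero D.basis using 2
  ext ⟨μ, i, j⟩
  rw [Matrix.mulVec_diagonal, coordMat_mulVec_classCoord]
  by_cases h1 : (j : ℕ) < D.d μ
  · by_cases h2 : p μ = 0 <;> simp [h1, h2]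
  · simp [h1]

theorem classState_evolve_mat (hdm : ∀ μ, D.d μ ≤ D.m μ) (p : stdSimplex ℝ D.Irr) (g : G) :
    ((D.classState hdm p).evolve U g).mat
      = Matrix.vecMulVec (U.mat g *ᵥ D.classVec p) (star (U.mat g *ᵥ D.classVec p)) := by
  rw [State.evolve, classState, State.ofVec]
  simp only [Matrix.mul_vecMulVec, Matrix.vecMulVec_mul, Matrix.star_mulVec]

/-- The vector of weights of the blocks of a state `C Cᴴ`. -/
def weightVec (C : Matrix (n × κ) R ℂ) (hC : (C * Cᴴ).trace = 1) : stdSimplex ℝ D.Irr :=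
  ⟨D.weight C, D.weight_nonneg C, D.sum_weight hC⟩

theorem sum_kraus_conjTranspose_mul_self (C : Matrix (n × κ) R ℂ) (h : G) :
    ∑ r, (D.kraus C r h)ᴴ * D.kraus C r h
      = D.basis * (Matrix.blockDiagonal' fun μ => (1 : Matrix (Fin (D.d μ)) (Fin (D.d μ)) ℂ) ⊗ₖ
        ∑ r, ∑ t, (krausBlock (√(D.d μ / D.weight C μ))
          ((D.irrep μ).mat h * D.blockRows C μ) t r)ᴴ *
          krausBlock (√(D.d μ / D.weight C μ)) ((D.irrep μ).mat h * D.blockRows C μ) t r)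
        * D.basisᴴ := by
  have h1 : ∀ r, (D.kraus C r h)ᴴ * D.kraus C r h
      = D.basis * ((D.krausCoord C r h)ᴴ * D.krausCoord C r h) * D.basisᴴ := by
    intro r
    simp only [kraus, Matrix.conjTranspose_mul, Matrix.conjTranspose_conjTranspose,
      Matrix.mul_assoc]
    rw [← Matrix.mul_assoc (D.ancillaBasis κ)ᴴ (D.ancillaBasis κ),
      D.conjTranspose_mul_ancillaBasis, Matrix.one_mul]
  have h2 : ∀ r, (D.krausCoord C r h)ᴴ * D.krausCoord C r h
      = Matrix.blockDiagonal' fun μ => (1 : Matrix (Fin (D.d μ)) (Fin (D.d μ)) ℂ) ⊗ₖ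
        ∑ t, (krausBlock (√(D.d μ / D.weight C μ))
          ((D.irrep μ).mat h * D.blockRows C μ) t r)ᴴ *
          krausBlock (√(D.d μ / D.weight C μ)) ((D.irrep μ).mat h * D.blockRows C μ) t r := by
    intro r
    set k := fun (t : κ) (μ : D.Irr) => (1 : Matrix (Fin (D.d μ)) (Fin (D.d μ)) ℂ) ⊗ₖ
      krausBlock (√(D.d μ / D.weight C μ)) ((D.irrep μ).mat h * D.blockRows C μ) t r with hk
    have h3 : (D.krausCoord C r h)ᴴ * D.krausCoord C r h
        = ∑ t, (Matrix.blockDiagonal' (k t))ᴴ * Matrix.blockDiagonal' (k t) := by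
      ext a b
      rw [Matrix.sum_apply, Matrix.mul_apply, Fintype.sum_prod_type, Finset.sum_comm]
      rfl
    rw [h3]
    have h4 : ∀ t, (Matrix.blockDiagonal' (k t))ᴴ * Matrix.blockDiagonal' (k t)
        = Matrix.blockDiagonal' fun μ => (1 : Matrix (Fin (D.d μ)) (Fin (D.d μ)) ℂ) ⊗ₖ
          ((krausBlock (√(D.d μ / D.weight C μ)) ((D.irrep μ).mat h * D.blockRows C μ) t r)ᴴ *
          krausBlock (√(D.d μ / D.weight C μ)) ((D.irrep μ).mat h * D.blockRows C μ) t r) := by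
      intro t
      rw [Matrix.blockDiagonal'_conjTranspose, ← Matrix.blockDiagonal'_mul]
      simp only [hk, Matrix.conjTranspose_kronecker, ← Matrix.mul_kronecker_mul,
        Matrix.conjTranspose_one, Matrix.one_mul]
    simp only [h4]
    ext ⟨μ, i, j⟩ ⟨ν, i', j'⟩
    rw [Matrix.sum_apply]
    by_cases hμ : μ = ν
    · subst hμ
      simp only [Matrix.blockDiagonal'_apply_eq, Matrix.kroneckerMap_apply, Matrix.sum_apply,
        Finset.mul_sum]
    · simp only [Matrix.blockDiagonal'_apply_ne _ _ _ hμ, Finset.sum_const_zero]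
  simp only [h1, h2]
  rw [← Matrix.sum_mul, ← Matrix.mul_sum]
  congr 2
  ext ⟨μ, i, j⟩ ⟨ν, i', j'⟩
  rw [Matrix.sum_apply]
  by_cases hμ : μ = ν
  · subst hμ
    simp only [Matrix.blockDiagonal'_apply_eq, Matrix.kroneckerMap_apply, Matrix.sum_apply,
      Finset.mul_sum]
  · simp only [Matrix.blockDiagonal'_apply_ne _ _ _ hμ, Finset.sum_const_zero]

variable [TopologicalSpace G]

theorem continuous_irrep_conj (hU : U.IsContinuous) (μ : D.Irr)
    (X : Matrix (Fin (D.d μ)) (Fin (D.d μ)) ℂ) (i j : Fin (D.d μ)) :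
    Continuous fun h => ((D.irrep μ).mat h * X * ((D.irrep μ).mat h)ᴴ) i j := by
  simp only [Matrix.mul_apply, Matrix.conjTranspose_apply, Finset.sum_mul]
  refine continuous_finsetSum _ fun a _ => continuous_finsetSum _ fun b _ => ?_
  refine ((hU.continuous_mul_star (D.irrep_mat_mem_entrySpan μ i b)
    (D.irrep_mat_mem_entrySpan μ j a)).mul (continuous_const (y := X b a))).congr fun h => ?_
  simp only [Pi.mul_apply]
  ring

variable [CompactSpace G] [MeasurableSpace G] [MeasurableMul₂ G]
  {haar : Measure G} [IsProbabilityMeasure haar] [haar.IsMulLeftInvariant]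

theorem integral_irrep_conj (hG : ∀ f : G → ℝ, Continuous f → Measurable f)
    (hU : U.IsContinuous) (μ : D.Irr) (X : Matrix (Fin (D.d μ)) (Fin (D.d μ)) ℂ)
    (i j : Fin (D.d μ)) :
    ∫ h, ((D.irrep μ).mat h * X * ((D.irrep μ).mat h)ᴴ) i j ∂haar
      = X.trace / D.d μ * (1 : Matrix (Fin (D.d μ)) (Fin (D.d μ)) ℂ) i j := by
  have := (D.irreducible μ).entryIntegral_conj (haar := haar) X fun a b =>
    integrable_of_continuous_complex hG (D.continuous_irrep_conj hU μ X a b) haar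
  simpa [entryIntegral] using congrFun (congrFun this i) j

/-- Schur averaging turns `U_h Ψ_μ Ψ_μᴴ U_hᴴ` into `(p_μ / d_μ) I`, which the factor `d_μ / p_μ`
normalizes. The mean is therefore the projection onto the blocks `H_μ ⊗ H_μ` with `p_μ ≠ 0`,
complementary to `remainder`. -/
theorem entryIntegral_sum_kraus (hG : ∀ f : G → ℝ, Continuous f → Measurable f)
    (hU : U.IsContinuous) (C : Matrix (n × κ) R ℂ) :
    entryIntegral haar (fun h => ∑ r, (D.kraus C r h)ᴴ * D.kraus C r h)
      + D.remainder (D.weight C) = 1 := by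
  have hsq : ∀ μ, ((√(D.d μ / D.weight C μ) : ℝ) : ℂ) * ((√(D.d μ / D.weight C μ) : ℝ) : ℂ)
      = (D.d μ : ℂ) / D.weight C μ := by
    intro μ
    rw [← Complex.ofReal_mul, Real.mul_self_sqrt (by
      have := D.weight_nonneg C μ; positivity)]
    simp
  have hconj : ∀ μ h, ((D.irrep μ).mat h * D.blockRows C μ) *
      ((D.irrep μ).mat h * D.blockRows C μ)ᴴ = (D.irrep μ).mat h *
        (D.blockRows C μ * (D.blockRows C μ)ᴴ) * ((D.irrep μ).mat h)ᴴ := by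
    intro μ h
    simp only [Matrix.conjTranspose_mul, Matrix.mul_assoc]
  simp only [sum_kraus_conjTranspose_mul_self]
  rw [entryIntegral_mul_mul, remainder, ← Matrix.add_mul, ← Matrix.mul_add]
  · have h0 : D.basis * (1 : Matrix (Σ μ, Fin (D.d μ) × Fin (D.m μ))
        (Σ μ, Fin (D.d μ) × Fin (D.m μ)) ℂ) * D.basisᴴ = (1 : Matrix n n ℂ) := by
      rw [Matrix.mul_one, D.basis_mul_conjTranspose]
    refine Eq.trans ?_ h0
    congr 2
    ext ⟨μ, i, j⟩ ⟨ν, i', j'⟩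
    rw [Matrix.add_apply, entryIntegral, Matrix.of_apply]
    by_cases hμ : μ = ν
    · subst hμ
      simp only [Matrix.blockDiagonal'_apply_eq, Matrix.kroneckerMap_apply,
        sum_krausBlock_conjTranspose_mul_self, hsq, hconj]
      rw [integral_const_mul]
      by_cases hi : i = i'
      · subst hi
        by_cases hj : (j : ℕ) < D.d μ
        · by_cases hj' : (j' : ℕ) < D.d μ
          · simp only [hj, hj', dif_pos]
            rw [integral_const_mul, D.integral_irrep_conj hG hU, D.trace_blockRows]
            have hd : (D.d μ : ℂ) ≠ 0 :=
              Nat.cast_ne_zero.2 (Fin.pos_iff_nonempty.2 (D.irreducible μ).1).ne'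
            by_cases hjj : j = j'
            · subst hjj
              -- When `p_μ = 0` the Kraus operators vanish on the block, and `remainder` is the
              -- identity on all of it.
              by_cases hw : D.weight C μ = 0
              · simp [hw]
              · have hw' : (D.weight C μ : ℂ) ≠ 0 := by exact_mod_cast hw
                simp [hw, hj]
                field_simp
            · have hne : (⟨j', hj'⟩ : Fin (D.d μ)) ≠ ⟨j, hj⟩ := fun h =>
                hjj (Fin.ext (Fin.mk.inj_iff.1 h).symm)
              simp [hne, hjj]
          · have hjj : j ≠ j' := fun h => hj' (h ▸ hj)
            simp [hj', hjj]
        · by_cases hjj : j = j'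
          · subst hjj; simp [hj]
          · simp [hj, hjj]
      · simp [hi]
    · simp [Matrix.blockDiagonal'_apply_ne _ _ _ hμ, hμ]
  · rintro ⟨μ, i, j⟩ ⟨ν, i', j'⟩
    by_cases hμ : μ = ν
    · subst hμ
      simp only [Matrix.blockDiagonal'_apply_eq, Matrix.kroneckerMap_apply,
        sum_krausBlock_conjTranspose_mul_self, hconj]
      refine Integrable.const_mul ?_ _
      by_cases hj : (j : ℕ) < D.d μ
      · by_cases hj' : (j' : ℕ) < D.d μ
        · simp only [hj, hj', dif_pos]
          exact (integrable_of_continuous_complex hG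
            (D.continuous_irrep_conj hU μ _ _ _) haar).const_mul _
        · simp [hj']
      · simp [hj]
    · simp [Matrix.blockDiagonal'_apply_ne _ _ _ hμ]

/-- Every state of `H ⊗ ℂ^κ` is reached by a right transfer from a class state. -/
theorem exists_isRightTransfer (hG : ∀ f : G → ℝ, Continuous f → Measurable f)
    (hU : U.IsContinuous) (hdm : ∀ μ, D.d μ ≤ D.m μ) (σ : State (n × κ)) :
    ∃ (p : stdSimplex ℝ D.Irr) (A : n × κ → G → Matrix (n × κ) n ℂ) (E : Matrix n n ℂ),
      IsRightTransfer haar U (U.withAncilla κ) (D.classState hdm p) σ A E := by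
  obtain ⟨C', hC'⟩ := CStarAlgebra.nonneg_iff_eq_star_mul_self.1 σ.posSemidef.nonneg
  -- The columns of `C` are unnormalized pure states with sum `σ`; their index becomes the Kraus
  -- index `r`.
  set C : Matrix (n × κ) (n × κ) ℂ := C'ᴴ with hCdef
  have hC : σ.mat = C * Cᴴ := by
    rw [hC', hCdef, Matrix.conjTranspose_conjTranspose, Matrix.star_eq_conjTranspose]
  have htr : (C * Cᴴ).trace = 1 := by rw [← hC, σ.trace_eq_one]
  have hcont : ∀ r a b c d, Continuous fun h => D.kraus C r h a b * star (D.kraus C r h c d) :=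
    fun r a b c d => hU.continuous_mul_star (D.kraus_mem_entrySpan C r a b)
      (D.kraus_mem_entrySpan C r c d)
  refine ⟨D.weightVec C htr, D.kraus C, D.remainder (D.weight C), ?_⟩
  refine
    { measurable := fun r a b c d => measurable_of_continuous_complex hG (hcont r a b c d)
      integrable := fun r a b c d => integrable_of_continuous_complex hG (hcont r a b c d) haar
      posSemidef := D.posSemidef_remainder _
      mul_evolve := fun g => ?_
      sum_eq := D.entryIntegral_sum_kraus hG hU C
      transfer := fun g h => ?_ }
  · rw [classState_evolve_mat, Matrix.mul_vecMulVec]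
    have := D.remainder_mulVec (D.weight C) g
    rw [show ((D.weightVec C htr : stdSimplex ℝ D.Irr) : D.Irr → ℝ) = D.weight C from rfl, this,
      Matrix.zero_vecMulVec]
  · rw [classState_evolve_mat,
      show ((D.weightVec C htr : stdSimplex ℝ D.Irr) : D.Irr → ℝ) = D.weight C from rfl]
    simp only [Matrix.mul_vecMulVec, Matrix.vecMulVec_mul, ← Matrix.star_mulVec,
      D.kraus_mulVec hdm]
    have : ∀ r, Matrix.vecMulVec
        (((U.withAncilla κ).mat g * (U.withAncilla κ).mat h) *ᵥ C.col r)
        (star (((U.withAncilla κ).mat g * (U.withAncilla κ).mat h) *ᵥ C.col r))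
        = ((U.withAncilla κ).mat g * (U.withAncilla κ).mat h)
          * Matrix.vecMulVec (C.col r) (star (C.col r))
          * ((U.withAncilla κ).mat g * (U.withAncilla κ).mat h)ᴴ := by
      intro r
      rw [Matrix.mul_vecMulVec, Matrix.vecMulVec_mul, Matrix.star_mulVec]
    simp only [this]
    rw [← Finset.sum_mul, ← Finset.mul_sum, sum_vecMulVec_col, ← hC]
    change _ = (U.withAncilla κ).mat (g * h) * σ.mat * ((U.withAncilla κ).mat (g * h))ᴴ
    -- `V_g V_h` and `V_{gh}` differ by a phase, which disappears under conjugation.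
    rw [← (U.withAncilla κ).mul_conj_mul, Matrix.conjTranspose_mul]
    simp only [Matrix.mul_assoc]

end IsotypicDecomposition

/-! ### Existence of the isotypic decomposition -/

theorem exists_isometry_onto_submodule {n : Type*} [Fintype n] (S : Submodule ℂ (n → ℂ)) :
    ∃ (d : ℕ) (V : Matrix n (Fin d) ℂ), Vᴴ * V = 1 ∧ (∀ x, V *ᵥ x ∈ S) ∧
      ∀ v ∈ S, V *ᵥ (Vᴴ *ᵥ v) = v := by
  -- An orthonormal basis is chosen in `EuclideanSpace`, since `n → ℂ` carries the sup norm; its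
  -- vectors are the columns of `V`.
  let e := (WithLp.linearEquiv 2 ℂ (n → ℂ)).symm
  let S' : Submodule ℂ (EuclideanSpace ℂ n) := S.map e.toLinearMap
  let b := stdOrthonormalBasis ℂ S'
  let V : Matrix n (Fin (Module.finrank ℂ S')) ℂ := Matrix.of fun i a => (b a : EuclideanSpace ℂ n) i
  have hinner : ∀ a (w : EuclideanSpace ℂ n), (Vᴴ *ᵥ (fun i => w i)) a
      = inner ℂ (b a : EuclideanSpace ℂ n) w := by
    intro a w
    rw [PiLp.inner_apply]
    simp only [Matrix.mulVec, dotProduct, Matrix.conjTranspose_apply, V, Matrix.of_apply]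
    exact Finset.sum_congr rfl fun i _ => by simp [mul_comm]
  have hmul : ∀ x i, (V *ᵥ x) i = ((∑ a, x a • b a : S') : EuclideanSpace ℂ n) i := by
    intro x i
    simp [Matrix.mulVec, dotProduct, V, mul_comm]
  refine ⟨_, V, ?_, fun x => ?_, fun v hv => ?_⟩
  · ext a a'
    have h1 : (Vᴴ * V) a a' = (Vᴴ *ᵥ (fun i => (b a' : EuclideanSpace ℂ n) i)) a := rfl
    rw [h1, hinner, ← Submodule.coe_inner, orthonormal_iff_ite.1 b.orthonormal, Matrix.one_apply]
  · obtain ⟨y, hy, hyx⟩ := (∑ a, x a • b a : S').2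
    have : V *ᵥ x = y := by
      ext i
      rw [hmul, ← hyx]
      rfl
    rwa [this]
  · let w : S' := ⟨e v, v, hv, rfl⟩
    have h2 := b.sum_repr' w
    ext i
    rw [hmul]
    have h3 : ∀ a, (Vᴴ *ᵥ v) a = inner ℂ (b a) w := fun a => hinner a (e v)
    simp only [h3]
    rw [h2]
    rfl

section Decomposition

variable {G : Type*} [Group G] {n m : Type*} [Fintype n] [DecidableEq n] [Fintype m]
  [DecidableEq m]

/-- Unitarity of both representations lets adjoints of intertwiners intertwine in the other
direction. Hence orthogonal complements of subrepresentations are invariant, and `Vᴴ V` commutes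
with `W`. -/
theorem conjTranspose_mul_mat_of_intertwines {U : ProjUnitaryRep G n} {W : ProjUnitaryRep G m}
    {V : Matrix n m ℂ} (h : ∀ g, U.mat g * V = V * W.mat g) (g : G) :
    Vᴴ * U.mat g = W.mat g * Vᴴ := by
  have h1 : (U.mat g)ᴴ * V = V * (W.mat g)ᴴ := by
    calc (U.mat g)ᴴ * V = (U.mat g)ᴴ * (V * W.mat g * (W.mat g)ᴴ) := by
          rw [Matrix.mul_assoc V, W.mul_conjTranspose_self, Matrix.mul_one]
      _ = V * (W.mat g)ᴴ := by
          rw [← h g, Matrix.mul_assoc, ← Matrix.mul_assoc _ᴴ, U.conjTranspose_mul_self,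
            Matrix.one_mul]
  have h2 := congrArg Matrix.conjTranspose h1
  simpa [Matrix.conjTranspose_mul] using h2

theorem ProjUnitaryRep.IsEquivalent.refl (U : ProjUnitaryRep G n) : U.IsEquivalent U :=
  ⟨1, 1, by simp, by simp, by simp⟩

theorem ProjUnitaryRep.IsEquivalent.symm {U : ProjUnitaryRep G n} {W : ProjUnitaryRep G m}
    (h : U.IsEquivalent W) : W.IsEquivalent U := by
  obtain ⟨T, T', h1, h2, h3⟩ := h
  refine ⟨T', T, h2, h1, fun g => ?_⟩
  calc W.mat g * T' = T' * T * W.mat g * T' := by rw [h2, Matrix.one_mul]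
    _ = T' * U.mat g * (T * T') := by
        rw [Matrix.mul_assoc T', ← h3 g]; simp only [Matrix.mul_assoc]
    _ = T' * U.mat g := by rw [h1, Matrix.mul_one]

theorem ProjUnitaryRep.IsEquivalent.trans {l : Type*} [Fintype l] [DecidableEq l]
    {U : ProjUnitaryRep G n} {W : ProjUnitaryRep G m} {Y : ProjUnitaryRep G l}
    (h : U.IsEquivalent W) (h' : W.IsEquivalent Y) : U.IsEquivalent Y := by
  obtain ⟨T, T', h1, h2, h3⟩ := h
  obtain ⟨S, S', k1, k2, k3⟩ := h'
  refine ⟨T * S, S' * T', ?_, ?_, fun g => ?_⟩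
  · rw [Matrix.mul_assoc, ← Matrix.mul_assoc S, k1, Matrix.one_mul, h1]
  · rw [Matrix.mul_assoc, ← Matrix.mul_assoc T', h2, Matrix.one_mul, k2]
  · rw [← Matrix.mul_assoc, h3, Matrix.mul_assoc, k3, Matrix.mul_assoc]

/-- Equivalent irreducible representations are related by a unitary intertwiner. -/
theorem ProjUnitaryRep.IsEquivalent.exists_unitary {U : ProjUnitaryRep G n}
    {W : ProjUnitaryRep G m} (h : U.IsEquivalent W) (hW : W.IsIrreducible) :
    ∃ T : Matrix n m ℂ, Tᴴ * T = 1 ∧ T * Tᴴ = 1 ∧ ∀ g, U.mat g * T = T * W.mat g := by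
  obtain ⟨T, T', h1, h2, h3⟩ := h
  -- By Schur `Tᴴ T` is a scalar `c`, which is positive since `T` is invertible; dividing `T` by
  -- `√c` makes it unitary.
  obtain ⟨c, hc⟩ := hW.exists_eq_smul_one (X := Tᴴ * T) fun g => by
    rw [← Matrix.mul_assoc, ← conjTranspose_mul_mat_of_intertwines h3 g, Matrix.mul_assoc, h3,
      Matrix.mul_assoc]
  obtain ⟨i⟩ := hW.1
  have hc0 : 0 ≤ c := by
    have := (Matrix.posSemidef_conjTranspose_mul_self T).diag_nonneg (i := i)
    rw [hc] at this
    simpa using this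
  have hcne : c ≠ 0 := by
    rintro rfl
    rw [zero_smul, Matrix.conjTranspose_mul_self_eq_zero] at hc
    rw [hc, Matrix.mul_zero] at h2
    simpa using congrFun (congrFun h2 i) i
  have hTT : T * Tᴴ = c • 1 := by
    have h4 : Tᴴ = c • T' := by
      calc Tᴴ = Tᴴ * T * T' := by rw [Matrix.mul_assoc, h1, Matrix.mul_one]
        _ = c • T' := by rw [hc, Matrix.smul_mul, Matrix.one_mul]
    rw [h4, Matrix.mul_smul, h1]
  have hcre : (c.re : ℂ) = c := Complex.ext rfl (Complex.le_def.1 hc0).2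
  have hpos : 0 < c.re := lt_of_le_of_ne (Complex.le_def.1 hc0).1 fun h => hcne (by
    rw [← hcre, ← h, Complex.ofReal_zero])
  have hs : star (((√c.re)⁻¹ : ℝ) : ℂ) * (((√c.re)⁻¹ : ℝ) : ℂ) * c = 1 := by
    rw [Complex.star_def, Complex.conj_ofReal, ← Complex.ofReal_mul, ← mul_inv,
      Real.mul_self_sqrt hpos.le]
    nth_rewrite 2 [← hcre]
    rw [← Complex.ofReal_mul, inv_mul_cancel₀ hpos.ne', Complex.ofReal_one]
  refine ⟨(((√c.re)⁻¹ : ℝ) : ℂ) • T, ?_, ?_, fun g => ?_⟩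
  · rw [Matrix.conjTranspose_smul, Matrix.smul_mul, Matrix.mul_smul, hc, smul_smul, smul_smul, hs,
      one_smul]
  · rw [Matrix.conjTranspose_smul, Matrix.smul_mul, Matrix.mul_smul, hTT, smul_smul, smul_smul,
      mul_comm (((√c.re)⁻¹ : ℝ) : ℂ), hs, one_smul]
  · rw [Matrix.mul_smul, h3, Matrix.smul_mul]

/-- An irreducible subrepresentation, given by an isometric intertwiner. -/
structure SubIrrep (U : ProjUnitaryRep G n) where
  /-- The dimension. -/
  d : ℕ
  /-- The irreducible representation. -/
  rep : ProjUnitaryRep G (Fin d)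
  /-- The isometric intertwiner. -/
  emb : Matrix n (Fin d) ℂ
  mult_eq : rep.mult = U.mult
  irreducible : rep.IsIrreducible
  isometry : embᴴ * emb = 1
  intertwines : ∀ g, U.mat g * emb = emb * rep.mat g

/-- The representation on an invariant subspace, the range of the isometry `V`. -/
def ProjUnitaryRep.compress (U : ProjUnitaryRep G n) (V : Matrix n m ℂ) (hV : Vᴴ * V = 1)
    (hinv : ∀ g, V * (Vᴴ * U.mat g * V) = U.mat g * V) : ProjUnitaryRep G m where
  mat g := Vᴴ * U.mat g * V
  mult := U.mult
  mat_unitary g := by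
    rw [Matrix.mem_unitaryGroup_iff', Matrix.star_eq_conjTranspose]
    have : (Vᴴ * U.mat g * V)ᴴ = Vᴴ * (U.mat g)ᴴ * V := by
      simp [Matrix.conjTranspose_mul, Matrix.mul_assoc]
    rw [this, Matrix.mul_assoc, hinv, Matrix.mul_assoc, ← Matrix.mul_assoc (U.mat g)ᴴ,
      U.conjTranspose_mul_self, Matrix.one_mul, hV]
  mat_one := by rw [U.mat_one, Matrix.mul_one, hV]
  mat_mul g h := by
    rw [Matrix.mul_assoc (Vᴴ * U.mat g), hinv, Matrix.mul_assoc, ← Matrix.mul_assoc (U.mat g),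
      U.mat_mul, Matrix.smul_mul, Matrix.mul_smul, Matrix.mul_assoc]
  norm_mult := U.norm_mult
  mult_cocycle := U.mult_cocycle
  mult_one_right := U.mult_one_right
  mult_one_left := U.mult_one_left

/-- Finite dimension gives a minimal nonzero invariant subspace of `S`. It is irreducible because
the isometry carries invariant subspaces of the compressed representation to invariant subspaces of
it. -/
theorem exists_subIrrep (U : ProjUnitaryRep G n) (S : Submodule ℂ (n → ℂ)) (hS : S ≠ ⊥)
    (hinv : ∀ g, ∀ v ∈ S, U.mat g *ᵥ v ∈ S) : ∃ F : SubIrrep U, ∀ x, F.emb *ᵥ x ∈ S := by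
  obtain ⟨T, ⟨hTS, hT0, hTinv⟩, hTmin⟩ := wellFounded_lt.has_min
    {T : Submodule ℂ (n → ℂ) | T ≤ S ∧ T ≠ ⊥ ∧ ∀ g, ∀ v ∈ T, U.mat g *ᵥ v ∈ T}
    ⟨S, le_rfl, hS, hinv⟩
  obtain ⟨d, V, hV, hVT, hTV⟩ := exists_isometry_onto_submodule T
  have hc : ∀ g, V * (Vᴴ * U.mat g * V) = U.mat g * V := by
    intro g
    refine Matrix.ext_of_mulVec_single fun i => ?_
    have := hTV _ (hTinv g _ (hVT (Pi.single i 1)))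
    simpa only [Matrix.mulVec_mulVec, Matrix.mul_assoc] using this
  have hcancel : ∀ x, Vᴴ *ᵥ (V *ᵥ x) = x := fun x => by
    rw [Matrix.mulVec_mulVec, hV, Matrix.one_mulVec]
  refine ⟨⟨d, U.compress V hV hc, V, rfl, ⟨?_, fun R hR => ?_⟩, hV, fun g => (hc g).symm⟩,
    fun x => hTS (hVT x)⟩
  · by_contra hd
    rw [not_nonempty_iff] at hd
    refine hT0 ((Submodule.eq_bot_iff _).2 fun v hv => ?_)
    rw [← hTV v hv]
    ext i
    simp [Matrix.mulVec, dotProduct]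
  · have hle : R.map V.mulVecLin ≤ T := by
      rintro _ ⟨x, _, rfl⟩
      exact hVT x
    by_cases h0 : R.map V.mulVecLin = ⊥
    · left
      refine (Submodule.eq_bot_iff _).2 fun x hx => ?_
      have : V *ᵥ x = 0 := (Submodule.eq_bot_iff _).1 h0 _ ⟨x, hx, rfl⟩
      rw [← hcancel x, this, Matrix.mulVec_zero]
    · right
      have hmem : R.map V.mulVecLin ∈ {T : Submodule ℂ (n → ℂ) |
          T ≤ S ∧ T ≠ ⊥ ∧ ∀ g, ∀ v ∈ T, U.mat g *ᵥ v ∈ T} := by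
        refine ⟨hle.trans hTS, h0, ?_⟩
        rintro g _ ⟨x, hx, rfl⟩
        refine ⟨_, hR g x hx, ?_⟩
        simp only [Matrix.mulVecLin_apply, Matrix.mulVec_mulVec]
        exact congrArg (· *ᵥ x) (hc g)
      have heq : R.map V.mulVecLin = T :=
        hle.lt_or_eq.resolve_left (hTmin _ hmem)
      refine Submodule.eq_top_iff'.2 fun x => ?_
      obtain ⟨y, hy, hyx⟩ : V *ᵥ x ∈ R.map V.mulVecLin := heq ▸ hVT x
      have : y = x := by
        rw [← hcancel y, ← hcancel x]
        exact congrArg _ hyx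
      exact this ▸ hy

/-- The orthogonal decomposition of a representation into irreducible subrepresentations. -/
theorem exists_orthogonal_subIrreps (U : ProjUnitaryRep G n) :
    ∃ (r : ℕ) (F : Fin r → SubIrrep U), (∀ a b, a ≠ b → (F a).embᴴ * (F b).emb = 0) ∧
      ∑ a, (F a).emb * (F a).embᴴ = 1 := by
  let P : ℕ → Prop := fun r => ∃ F : Fin r → SubIrrep U,
    ∀ a b, a ≠ b → (F a).embᴴ * (F b).emb = 0
  -- One basis vector from each member gives an orthonormal system, so the size of an orthogonal
  -- family is bounded by the dimension.
  have hle : ∀ r, P r → r ≤ Fintype.card n := by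
    rintro r ⟨F, hF⟩
    let i : ∀ a, Fin (F a).d := fun a => (F a).irreducible.1.some
    let M : Matrix n (Fin r) ℂ := Matrix.of fun x a => (F a).emb x (i a)
    have hM : Mᴴ * M = 1 := by
      ext a b
      have h1 : (Mᴴ * M) a b = ((F a).embᴴ * (F b).emb) (i a) (i b) := rfl
      rw [h1]
      by_cases hab : a = b
      · subst hab
        rw [(F a).isometry, Matrix.one_apply_eq, Matrix.one_apply_eq]
      · rw [hF a b hab, Matrix.one_apply_ne hab, Matrix.zero_apply]
    have h2 := Matrix.rank_mul_le_right Mᴴ M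
    rw [hM, Matrix.rank_one, Fintype.card_fin] at h2
    exact h2.trans (Matrix.rank_le_card_height M)
  obtain ⟨r, ⟨F, hF⟩, hr⟩ : ∃ r, P r ∧ ¬ P (r + 1) := by
    by_contra! hcon
    have : ∀ r, P r := fun r => by
      induction r with
      | zero => exact ⟨fun a => a.elim0, fun a => a.elim0⟩
      | succ r ih => exact hcon r ih
    exact absurd (hle _ (this (Fintype.card n + 1))) (by omega)
  -- The orthogonal complement of the family; if nonzero, it would contain a further irreducible
  -- subrepresentation, contrary to `¬ P (r + 1)`.
  let S : Submodule ℂ (n → ℂ) := ⨅ a, LinearMap.ker (F a).embᴴ.mulVecLin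
  have hS : ∀ v, v ∈ S ↔ ∀ a, (F a).embᴴ *ᵥ v = 0 := fun v => by
    simp [S, Submodule.mem_iInf, LinearMap.mem_ker]
  have hS0 : S = ⊥ := by
    by_contra hne
    obtain ⟨E, hE⟩ := exists_subIrrep U S hne fun g v hv => by
      rw [hS] at hv ⊢
      intro a
      rw [Matrix.mulVec_mulVec, conjTranspose_mul_mat_of_intertwines (F a).intertwines g,
        ← Matrix.mulVec_mulVec, hv a, Matrix.mulVec_zero]
    have hFE : ∀ a, (F a).embᴴ * E.emb = 0 := fun a => by
      refine Matrix.ext_of_mulVec_single fun i => ?_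
      rw [← Matrix.mulVec_mulVec, (hS _).1 (hE _) a, Matrix.zero_mulVec]
    have hEF : ∀ a, E.embᴴ * (F a).emb = 0 := fun a => by
      have := congrArg Matrix.conjTranspose (hFE a)
      simpa [Matrix.conjTranspose_mul] using this
    refine hr ⟨Fin.cons E F, fun a b => ?_⟩
    refine Fin.cases ?_ (fun a => ?_) a <;> refine Fin.cases ?_ (fun b => ?_) b
    · simp
    · intro _
      exact hEF b
    · intro _
      exact hFE a
    · intro hab
      exact hF a b fun h => hab (h ▸ rfl)
  refine ⟨r, F, hF, ?_⟩
  refine Matrix.ext_of_mulVec_single fun i => ?_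
  set v : n → ℂ := Pi.single i 1
  have hmem : v - (∑ a, (F a).emb * (F a).embᴴ) *ᵥ v ∈ S := by
    rw [hS]
    intro b
    rw [Matrix.mulVec_sub, Matrix.mulVec_mulVec, Matrix.mul_sum, Finset.sum_eq_single b]
    · rw [← Matrix.mul_assoc, (F b).isometry, Matrix.one_mul, sub_self]
    · intro a _ hab
      rw [← Matrix.mul_assoc, hF b a hab.symm, Matrix.zero_mul]
    · simp
  rw [hS0, Submodule.mem_bot, sub_eq_zero] at hmem
  rw [Matrix.one_mulVec, ← hmem]

/-- The irreducible subrepresentations are grouped into equivalence classes, and the class size is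
the multiplicity. Composing each embedding with a unitary intertwiner from the class representative
makes all copies in a class carry the same matrices, so the classes become the blocks `U^μ ⊗ I`. -/
theorem nonempty_isotypicDecomposition (U : ProjUnitaryRep G n) :
    Nonempty (IsotypicDecomposition U) := by
  classical
  obtain ⟨r, F, hF, hsum⟩ := exists_orthogonal_subIrreps U
  let s : Setoid (Fin r) :=
    { r := fun a b => (F a).rep.IsEquivalent (F b).rep
      iseqv := ⟨fun a => .refl _, fun h => h.symm, fun h h' => h.trans h'⟩ }
  let q : Fin r → Quotient s := fun a => ⟦a⟧
  let d : Quotient s → ℕ := fun μ => (F μ.out).d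
  have hT : ∀ (μ : Quotient s) (a : {a // q a = μ}), ∃ T : Matrix (Fin (F a.1).d) (Fin (d μ)) ℂ,
      Tᴴ * T = 1 ∧ T * Tᴴ = 1 ∧ ∀ g, (F a.1).rep.mat g * T = T * (F μ.out).rep.mat g := by
    rintro μ ⟨a, rfl⟩
    have : (F a).rep.IsEquivalent (F (q a).out).rep := (Quotient.mk_out a : s _ _).symm
    exact this.exists_unitary (F (q a).out).irreducible
  choose T hT1 hT2 hT3 using hT
  let m : Quotient s → ℕ := fun μ => Fintype.card {a // q a = μ}
  let e : ∀ μ, Fin (m μ) ≃ {a // q a = μ} := fun μ => (Fintype.equivFin _).symm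
  let V : ∀ μ, Fin (m μ) → Matrix n (Fin (d μ)) ℂ :=
    fun μ j => (F (e μ j).1).emb * T μ (e μ j)
  let B : Matrix n (Σ μ, Fin (d μ) × Fin (m μ)) ℂ := Matrix.of fun x y => V y.1 y.2.2 x y.2.1
  have hVV : ∀ μ j, (V μ j)ᴴ * V μ j = 1 := fun μ j => by
    simp only [V, Matrix.conjTranspose_mul]
    rw [Matrix.mul_assoc, ← Matrix.mul_assoc _ᴴ (F _).emb, (F _).isometry, Matrix.one_mul, hT1]
  have hVV' : ∀ μ j, V μ j * (V μ j)ᴴ = (F (e μ j).1).emb * (F (e μ j).1).embᴴ := fun μ j => by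
    simp only [V, Matrix.conjTranspose_mul]
    rw [Matrix.mul_assoc, ← Matrix.mul_assoc (T μ _), hT2, Matrix.one_mul]
  have hVne : ∀ μ j ν k, (e μ j).1 ≠ (e ν k).1 → (V μ j)ᴴ * V ν k = 0 := fun μ j ν k h => by
    simp only [V, Matrix.conjTranspose_mul]
    rw [Matrix.mul_assoc, ← Matrix.mul_assoc _ᴴ (F _).emb, hF _ _ h, Matrix.zero_mul,
      Matrix.mul_zero]
  have hUV : ∀ g μ j, U.mat g * V μ j = V μ j * (F μ.out).rep.mat g := fun g μ j => by
    simp only [V]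
    rw [← Matrix.mul_assoc, (F _).intertwines, Matrix.mul_assoc, hT3, Matrix.mul_assoc]
  have hBB : B * Bᴴ = 1 := by
    rw [← hsum]
    have h1 : B * Bᴴ = ∑ μ, ∑ j, V μ j * (V μ j)ᴴ := by
      ext x y
      simp only [Matrix.mul_apply, Matrix.sum_apply, Fintype.sum_sigma, Fintype.sum_prod_type,
        Matrix.conjTranspose_apply, B, Matrix.of_apply]
      exact Finset.sum_congr rfl fun μ _ => Finset.sum_comm
    rw [h1]
    simp only [hVV']
    have h2 : ∀ μ, ∑ j, (F (e μ j).1).emb * (F (e μ j).1).embᴴ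
        = ∑ a : {a // q a = μ}, (F a.1).emb * (F a.1).embᴴ := fun μ =>
      (e μ).sum_comp fun a => (F a.1).emb * (F a.1).embᴴ
    simp only [h2]
    rw [← (Equiv.sigmaFiberEquiv q).sum_comp, Fintype.sum_sigma]
    rfl
  have hBB' : Bᴴ * B = 1 := by
    ext ⟨μ, i, j⟩ ⟨ν, i', j'⟩
    have h1 : (Bᴴ * B) ⟨μ, i, j⟩ ⟨ν, i', j'⟩ = ((V μ j)ᴴ * V ν j') i i' := rfl
    rw [h1]
    by_cases hμ : μ = ν
    · subst hμ
      by_cases hj : j = j'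
      · subst hj
        rw [hVV]
        simp [Matrix.one_apply]
      · rw [hVne μ j μ j' fun h => hj ((e μ).injective (Subtype.ext h))]
        simp [hj]
    · rw [hVne μ j ν j' fun h => hμ (by rw [← (e μ j).2, ← (e ν j').2, h])]
      simp [hμ]
  refine ⟨{
    Irr := Quotient s
    fintypeIrr := inferInstance
    decidableEqIrr := inferInstance
    d := d
    m := m
    irrep := fun μ => (F μ.out).rep
    mult_irrep := fun μ => (F μ.out).mult_eq
    irreducible := fun μ => (F μ.out).irreducible
    inequivalent := fun μ ν hμν h => hμν ?_
    m_pos := fun μ => Fintype.card_pos_iff.2 ⟨μ.out, Quotient.out_eq μ⟩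
    basis := B
    basis_mul_conjTranspose := hBB
    conjTranspose_mul_basis := hBB'
    mat_eq := fun g => ?_ }⟩
  · rw [← Quotient.out_eq μ, ← Quotient.out_eq ν]
    exact Quotient.sound h
  · have h1 : U.mat g * B = B * Matrix.blockDiagonal' fun μ =>
        (F μ.out).rep.mat g ⊗ₖ (1 : Matrix (Fin (m μ)) (Fin (m μ)) ℂ) := by
      ext x ⟨μ, i, j⟩
      have h2 : (U.mat g * B) x ⟨μ, i, j⟩ = (U.mat g * V μ j) x i := rfl
      rw [h2, hUV, Matrix.mul_apply, Matrix.mul_apply, Fintype.sum_sigma,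
        Finset.sum_eq_single μ]
      · rw [Fintype.sum_prod_type]
        refine Finset.sum_congr rfl fun i' _ => ?_
        rw [Finset.sum_eq_single j]
        · simp [B]
        · intro k _ hk
          simp [hk]
        · simp
      · intro ν _ hν
        refine Finset.sum_eq_zero fun y _ => ?_
        rw [Matrix.blockDiagonal'_apply_ne _ _ _ hν, mul_zero]
      · simp
    rw [← h1, Matrix.mul_assoc, hBB, Matrix.mul_one]

end Decomposition

/-! ### Strategies without ancilla as strategies with a one-dimensional ancilla -/

section TrivialAncilla

theorem submatrix_fst_mul_submatrix_fst {n : Type*} [Fintype n] (A B : Matrix n n ℂ) :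
    (A.submatrix Prod.fst Prod.fst : Matrix (n × Fin 1) (n × Fin 1) ℂ)
        * B.submatrix Prod.fst Prod.fst
      = (A * B).submatrix Prod.fst Prod.fst := by
  ext i j
  simp [Matrix.mul_apply, Fintype.sum_prod_type]

variable {G : Type*} [MeasurableSpace G] {n : Type*} [Fintype n] [DecidableEq n]

/-- A state, regarded as a state with a one-dimensional ancilla. -/
def State.withUnit (ρ : State n) : State (n × Fin 1) where
  mat := ρ.mat.submatrix Prod.fst Prod.fst
  posSemidef := ρ.posSemidef.submatrix _
  trace_eq_one := by
    rw [← ρ.trace_eq_one]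
    simp [Matrix.trace, Fintype.sum_prod_type]

/-- A measurement, regarded as a measurement on the system with a one-dimensional ancilla. -/
def POVM.withUnit (P : POVM G n) : POVM G (n × Fin 1) where
  toVectorMeasure := P.toVectorMeasure.mapRange
    (AddMonoidHom.mk' (fun A : Matrix n n ℂ => A.submatrix (Prod.fst : n × Fin 1 → n) Prod.fst)
      fun _ _ => rfl)
    (continuous_id.matrix_submatrix _ _)
  posSemidef B := (P.posSemidef B).submatrix _
  univ_eq_one := by
    change (P.toVectorMeasure Set.univ).submatrix Prod.fst Prod.fst = 1
    rw [P.univ_eq_one]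
    ext i j
    have h : (i.1 = j.1) ↔ i = j := ⟨fun h => Prod.ext h (Subsingleton.elim _ _), fun h => h ▸ rfl⟩
    simp [Matrix.one_apply, h]

theorem bornMeasure_withUnit (P : POVM G n) (ρ : State n) :
    bornMeasure P.withUnit ρ.withUnit = bornMeasure P ρ := by
  ext B hB
  rw [bornMeasure_apply _ _ hB, bornMeasure_apply _ _ hB]
  have h : P.withUnit.toVectorMeasure B * ρ.withUnit.mat
      = (P.toVectorMeasure B * ρ.mat).submatrix Prod.fst Prod.fst :=
    submatrix_fst_mul_submatrix_fst _ _
  rw [h]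
  congr 2
  simp [Matrix.trace, Fintype.sum_prod_type]

variable [Group G] {U : ProjUnitaryRep G n}

theorem State.withUnit_evolve {G : Type*} [Group G] {U : ProjUnitaryRep G n}
    (ρ : State n) (g : G) :
    ρ.withUnit.evolve (U.withAncilla (Fin 1)) g = (ρ.evolve U g).withUnit := by
  have hU : (U.withAncilla (Fin 1)).mat g = (U.mat g).submatrix Prod.fst Prod.fst := by
    ext i j
    have h : i.2 = j.2 := Subsingleton.elim _ _
    simp [ProjUnitaryRep.withAncilla, Matrix.kroneckerMap_apply, Matrix.one_apply, h]
  have h : (ρ.withUnit.evolve (U.withAncilla (Fin 1)) g).mat = (ρ.evolve U g).withUnit.mat := by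
    simp only [State.evolve, State.withUnit, hU, Matrix.conjTranspose_submatrix,
      submatrix_fst_mul_submatrix_fst]
  cases h1 : ρ.withUnit.evolve (U.withAncilla (Fin 1)) g
  cases h2 : (ρ.evolve U g).withUnit
  rw [h1, h2] at h
  subst h
  rfl

theorem condCost_withUnit (c : G → G → ℝ) (ρ : State n) (P : POVM G n) (g : G) :
    condCost c (U.withAncilla (Fin 1)) ρ.withUnit P.withUnit g = condCost c U ρ P g := by
  rw [condCost, condCost, State.withUnit_evolve, bornMeasure_withUnit]

/-- The infimum over ancillas includes `k = 1`, which reproduces every strategy on `H` alone. -/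
theorem optimalAverageCost_le (haar : Measure G) (c : G → G → ℝ) (ρ : State n) :
    optimalAverageCost haar c U ≤ bestAverageCost haar c U ρ := by
  refine le_iInf fun P => ((iInf₂_le 1 ρ.withUnit).trans (iInf_le _ P.withUnit)).trans ?_
  simp only [averageCost, condCost_withUnit, le_refl]

theorem optimalWorstCaseCost_le (c : G → G → ℝ) (ρ : State n) :
    optimalWorstCaseCost c U ≤ bestWorstCaseCost c U ρ := by
  refine le_iInf fun P => ((iInf₂_le 1 ρ.withUnit).trans (iInf_le _ P.withUnit)).trans ?_
  simp only [worstCaseCost, condCost_withUnit, le_refl]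

end TrivialAncilla

/-- Excludes `k = 0`: the density of a POVM was built from the maximally mixed state, which requires
a nonempty index type. -/
theorem State.nonempty {n : Type*} [Fintype n] (ρ : State n) : Nonempty n := by
  by_contra h
  rw [not_nonempty_iff] at h
  simpa [Matrix.trace] using ρ.trace_eq_one

end GroupEstimation

end

/-! ### The theorem -/

theorem mainTheorem2 {G : Type*} [Group G] [TopologicalSpace G] [IsTopologicalGroup G]
    [CompactSpace G] [MeasurableSpace G] [MeasurableMul₂ G] [MeasurableInv G]
    -- `G` carries its Borel σ-algebra if it is second countable, or its Baire σ-algebra in general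
    (hG : ∀ f : G → ℝ, Continuous f → Measurable f)
    (haar : Measure G) [IsProbabilityMeasure haar] [haar.IsMulLeftInvariant]
    {n : Type*} [Fintype n] [DecidableEq n]
    (U : ProjUnitaryRep G n) (hU : U.IsContinuous)
    (c : G → G → ℝ) (hc : Measurable fun x : G × G => c x.1 x.2)
    (hmin : ∀ x g, c g g ≤ c x g)
    (hright : ∀ x g h, c (x * h) (g * h) = c x g) :
    Nonempty (IsotypicDecomposition U) ∧
    ∀ (D : IsotypicDecomposition U) (hdm : ∀ μ, D.d μ ≤ D.m μ),
      ∀ (k : ℕ) (σ : State (n × Fin k)), ∃ p : stdSimplex ℝ D.Irr,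
        (∀ Q : POVM G (n × Fin k), ∃ P : POVM G n,
          averageCost haar c U (D.classState hdm p) P ≤
            averageCost haar c (U.withAncilla (Fin k)) σ Q ∧
          worstCaseCost c U (D.classState hdm p) P ≤
            worstCaseCost c (U.withAncilla (Fin k)) σ Q) ∧
        (bestAverageCost haar c (U.withAncilla (Fin k)) σ = optimalAverageCost haar c U →
          bestAverageCost haar c U (D.classState hdm p) = optimalAverageCost haar c U) ∧
        (bestWorstCaseCost c (U.withAncilla (Fin k)) σ = optimalWorstCaseCost c U →
          bestWorstCaseCost c U (D.classState hdm p) = optimalWorstCaseCost c U) := by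
  refine ⟨nonempty_isotypicDecomposition U, fun D hdm k σ => ?_⟩
  have hne : Nonempty (n × Fin k) := σ.nonempty
  obtain ⟨p, A, E, hA⟩ := D.exists_isRightTransfer (haar := haar) hG hU hdm σ
  have hm : ∀ i j, Measurable fun g => (σ.evolve (U.withAncilla (Fin k)) g).mat i j := fun i j =>
    measurable_of_continuous_complex hG ((hU.withAncilla (Fin k)).continuous_evolve σ i j)
  have hP : ∀ Q : POVM G (n × Fin k), ∃ P : POVM G n,
      averageCost haar c U (D.classState hdm p) P ≤
        averageCost haar c (U.withAncilla (Fin k)) σ Q ∧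
      worstCaseCost c U (D.classState hdm p) P ≤
        worstCaseCost c (U.withAncilla (Fin k)) σ Q := fun Q =>
    (hA.exists_condCost_eq hc hmin hright hm Q).imp fun P => averageCost_and_worstCaseCost_le
  refine ⟨p, hP, fun h => ?_, fun h => ?_⟩
  · refine le_antisymm (h ▸ le_iInf fun Q => ?_) (optimalAverageCost_le haar c _)
    obtain ⟨P, hP, -⟩ := hP Q
    exact (iInf_le _ P).trans hP
  · refine le_antisymm (h ▸ le_iInf fun Q => ?_) (optimalWorstCaseCost_le c _)
    obtain ⟨P, -, hP⟩ := hP Q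
    exact (iInf_le _ P).trans hP
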